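/- Let $k$ be a field of characteristic $0$ (all coalgebras are coassociative and counital over $k$, all comodules coassociative and counital, and $\otimes=\otimes_k$). For a coalgebra $B$, a right $B$-comodule $M$ and a left $B$-comodule $N$, let $\mathrm{Cotor}^n_B(M,N)$ be the $n$-th cohomology of the two-sided cobar complex $M\otimes B^{\otimes *}\otimes N$, whose differential $M\otimes B^{\otimes n}\otimes N\to M\otimes B^{\otimes (n+1)}\otimes N$ is $$m\otimes b_1\otimes\cdots\otimes b_n\otimes w\mapsto m_{0}\otimes m_{1}\otimes b_1\otimes\cdots\otimes w+\sum_{i=1}^n(-1)^i\, m\otimes\cdots\otimes\Delta(b_i)\otimes\cdots\otimes w+(-1)^{n+1}m\otimes b_1\otimes\cdots\otimes b_n\otimes w_{-1}\otimes w_{0},$$ and let $M\,\Box_B\,N=\ker\big(M\otimes N\to M\otimes B\otimes N\big)$ be the cotensor product, the kernel of the map $m\otimes w\mapsto m_0\otimes m_1\otimes w-m\otimes w_{-1}\otimes w_0$. Let $\pi:\mathcal C\to\mathcal D$ be a coalgebra coextension, that is, a homomorphism of coalgebras; through $\pi$ every right (left) $\mathcal C$-comodule, in particular $\mathcal C$ itself,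 is a right (left) $\mathcal D$-comodule. Assume that $\mathcal C$ is coflat both as a right and as a left $\mathcal D$-comodule, i.e. $\mathrm{Cotor}^n_{\mathcal D}(\mathcal C,N)=0$ for all $n\ge 1$ and all left $\mathcal D$-comodules $N$, and $\mathrm{Cotor}^n_{\mathcal D}(M,\mathcal C)=0$ for all $n\ge 1$ and all right $\mathcal D$-comodules $M$. Let $V$ be a right $\mathcal C$-comodule and $W$ a left $\mathcal C$-comodule. For $i\ge 0$ let $\mathcal C^{\Box_{\mathcal D}\,i}\,\Box_{\mathcal D}\,W$ be the left $\mathcal D$-comodule defined by $\mathcal C^{\Box_{\mathcal D}\,0}\,\Box_{\mathcal D}\,W=W$ and $\mathcal C^{\Box_{\mathcal D}\,(i+1)}\,\Box_{\mathcal D}\,W=\mathcal C\,\Box_{\mathcal D}\,(\mathcal C^{\Box_{\mathcal D}\,i}\,\Box_{\mathcal D}\,W)$, where $\mathcal D$ coacts on $\mathcal C\,\Box_{\mathcal D}\,T$ by $c\otimes t\mapsto\pi(c_{(1)})\otimes c_{(2)}\otimes t$. Then there is a first quadrant cohomological spectral sequence $(E_r^{i,j},d_r)_{r\ge 1}$ of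 $k$-vector spaces, with $d_r$ of bidegree $(r,1-r)$, such that $$E_1^{i,j}\cong\mathrm{Cotor}^j_{\mathcal D}\big(V,\ \mathcal C^{\Box_{\mathcal D}\,i}\,\Box_{\mathcal D}\,W\big)\qquad(i,j\ge 0),$$ and which converges to $\mathrm{Cotor}^{i+j}_{\mathcal C}(V,W)$: each $H^n=\mathrm{Cotor}^n_{\mathcal C}(V,W)$ has a decreasing filtration $H^n=F^0H^n\supseteq F^1H^n\supseteq\cdots\supseteq F^{n+1}H^n=0$ by subspaces with $F^iH^{i+j}/F^{i+1}H^{i+j}\cong E_\infty^{i,j}$ for all $i,j\ge0$, where $E_\infty^{i,j}$ is the stable value of $E_r^{i,j}$, attained for all $r>\max(i,j+1)$. -/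

import Mathlib

open scoped TensorProduct

universe u v

/-! ### Comodules over a coalgebra -/

/-- A right comodule over the `k`-coalgebra `C`: a `k`-vector space with a coassociative and
counital right coaction `m ↦ m₀ ⊗ m₁`. -/
structure RightComodule (k : Type u) [Field k] (C : Type v) [AddCommGroup C] [Module k C]
    [Coalgebra k C] where
  carrier : Type v
  [addCommGroup : AddCommGroup carrier]
  [module : Module k carrier]
  coact : carrier →ₗ[k] carrier ⊗[k] C
  coassoc : (TensorProduct.assoc k carrier C C).toLinearMap ∘ₗ coact.rTensor C ∘ₗ coact =
    (Coalgebra.comul (R := k) (A := C)).lTensor carrier ∘ₗ coact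
  counit_coact : (Coalgebra.counit (R := k) (A := C)).lTensor carrier ∘ₗ coact =
    (TensorProduct.mk k carrier k).flip 1

/-- A left comodule over the `k`-coalgebra `C`: a `k`-vector space with a coassociative and
counital left coaction `m ↦ m₋₁ ⊗ m₀`. -/
structure LeftComodule (k : Type u) [Field k] (C : Type v) [AddCommGroup C] [Module k C]
    [Coalgebra k C] where
  carrier : Type v
  [addCommGroup : AddCommGroup carrier]
  [module : Module k carrier]
  coact : carrier →ₗ[k] C ⊗[k] carrier
  coassoc : (TensorProduct.assoc k C C carrier).toLinearMap ∘ₗ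
      (Coalgebra.comul (R := k) (A := C)).rTensor carrier ∘ₗ coact =
    coact.lTensor C ∘ₗ coact
  counit_coact : (Coalgebra.counit (R := k) (A := C)).rTensor carrier ∘ₗ coact =
    TensorProduct.mk k k carrier 1

attribute [instance] RightComodule.addCommGroup RightComodule.module
  LeftComodule.addCommGroup LeftComodule.module

section Comodules

variable {k : Type u} [Field k] {C D : Type v} [AddCommGroup C] [Module k C] [Coalgebra k C]
  [AddCommGroup D] [Module k D] [Coalgebra k D]

/-- The right `D`-comodule `v ↦ v₀ ⊗ π(v₁)` obtained from a right `C`-comodule along a coalgebra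
map `π : C → D`. -/
def RightComodule.corestrict (V : RightComodule k C) (π : C →ₗc[k] D) : RightComodule k D where
  carrier := V.carrier
  coact := π.toLinearMap.lTensor V.carrier ∘ₗ V.coact
  coassoc := by
    have e1 : (TensorProduct.assoc k V.carrier D D).toLinearMap ∘ₗ
        (π.toLinearMap.lTensor V.carrier).rTensor D ∘ₗ
        π.toLinearMap.lTensor (V.carrier ⊗[k] C) =
        (TensorProduct.map π.toLinearMap π.toLinearMap).lTensor V.carrier ∘ₗ
        (TensorProduct.assoc k V.carrier C C).toLinearMap := by
      ext v c c'
      simp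
    ext v
    have h1 := LinearMap.congr_fun V.coassoc v
    have h2 := congrArg (fun f => f.lTensor V.carrier (V.coact v)) π.map_comp_comul
    simp only [LinearMap.lTensor_comp, LinearMap.comp_apply, LinearMap.rTensor_comp] at h1 h2 ⊢
    rw [← h2, ← h1]
    have h3 := LinearMap.congr_fun e1 (V.coact.rTensor C (V.coact v))
    simp only [LinearMap.comp_apply] at h3
    rw [← h3]
    congr 2
    exact LinearMap.congr_fun ((LinearMap.rTensor_comp_lTensor _ V.coact π.toLinearMap).trans
      (LinearMap.lTensor_comp_rTensor _ V.coact π.toLinearMap).symm) (V.coact v)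
  counit_coact := by
    have h1 := V.counit_coact
    have h2 := π.counit_comp
    rw [← LinearMap.comp_assoc, ← LinearMap.lTensor_comp]
    exact (congrArg (fun f => f.lTensor V.carrier ∘ₗ V.coact) h2).trans h1

/-- The left `D`-comodule `w ↦ π(w₋₁) ⊗ w₀` obtained from a left `C`-comodule along a coalgebra
map `π : C → D`. -/
def LeftComodule.corestrict (W : LeftComodule k C) (π : C →ₗc[k] D) : LeftComodule k D where
  carrier := W.carrier
  coact := π.toLinearMap.rTensor W.carrier ∘ₗ W.coact
  coassoc := by
    have e1 : (TensorProduct.assoc k D D W.carrier).toLinearMap ∘ₗ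
        (TensorProduct.map π.toLinearMap π.toLinearMap).rTensor W.carrier =
        (π.toLinearMap.rTensor W.carrier).lTensor D ∘ₗ
        π.toLinearMap.rTensor (C ⊗[k] W.carrier) ∘ₗ
        (TensorProduct.assoc k C C W.carrier).toLinearMap := by
      ext c c' w
      simp
    ext w
    have h1 := LinearMap.congr_fun W.coassoc w
    have h2 := congrArg (fun f => f.rTensor W.carrier (W.coact w)) π.map_comp_comul
    simp only [LinearMap.lTensor_comp, LinearMap.comp_apply, LinearMap.rTensor_comp] at h1 h2 ⊢
    rw [← h2]
    have h3 := LinearMap.congr_fun e1 (Coalgebra.comul.rTensor W.carrier (W.coact w))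
    simp only [LinearMap.comp_apply] at h3
    rw [h3, h1]
    congr 1
    exact LinearMap.congr_fun ((LinearMap.rTensor_comp_lTensor _ π.toLinearMap W.coact).trans
      (LinearMap.lTensor_comp_rTensor _ π.toLinearMap W.coact).symm) (W.coact w)
  counit_coact := by
    have h1 := W.counit_coact
    have h2 := π.counit_comp
    rw [← LinearMap.comp_assoc, ← LinearMap.rTensor_comp]
    exact (congrArg (fun f => f.rTensor W.carrier ∘ₗ W.coact) h2).trans h1

variable (k C) in
/-- The coalgebra `C` as a right comodule over itself. -/
def RightComodule.regular : RightComodule k C where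
  carrier := C
  coact := Coalgebra.comul
  coassoc := Coalgebra.coassoc
  counit_coact := Coalgebra.lTensor_counit_comp_comul

variable (k C) in
/-- The coalgebra `C` as a left comodule over itself. -/
def LeftComodule.regular : LeftComodule k C where
  carrier := C
  coact := Coalgebra.comul
  coassoc := Coalgebra.coassoc
  counit_coact := Coalgebra.rTensor_counit_comp_comul

end Comodules

/-! ### The two-sided cobar complex and `Cotor` -/

section Cobar

variable {k : Type u} [Field k] {C : Type v} [AddCommGroup C] [Module k C] [Coalgebra k C]

/-- The space `C ⊗ (C ⊗ (⋯ ⊗ (C ⊗ W)))` with `n` factors `C`. -/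
def cobarObj (W : LeftComodule k C) : ℕ → ModuleCat.{v} k
  | 0 => ModuleCat.of k W.carrier
  | n + 1 => ModuleCat.of k (C ⊗[k] cobarObj W n)

/-- The map `m ⊗ x ↦ m₀ ⊗ (m₁ ⊗ x) - m ⊗ δ(x)`, for a map `ρ : m ↦ m₀ ⊗ m₁`. -/
noncomputable def cobarStep {M X : Type v} [AddCommGroup M] [Module k M] [AddCommGroup X]
    [Module k X] (ρ : M →ₗ[k] M ⊗[k] C) (δ : X →ₗ[k] C ⊗[k] X) :
    M ⊗[k] X →ₗ[k] M ⊗[k] (C ⊗[k] X) :=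
  (TensorProduct.assoc k M C X).toLinearMap ∘ₗ ρ.rTensor X - δ.lTensor M

/-- The map `C^{⊗ n} ⊗ W → C^{⊗ (n + 1)} ⊗ W` sending `c₁ ⊗ ⋯ ⊗ cₙ ⊗ w` to the alternating sum
`Δ(c₁) ⊗ c₂ ⊗ ⋯ ⊗ w - c₁ ⊗ Δ(c₂) ⊗ ⋯ ⊗ w + ⋯ + (-1)^n c₁ ⊗ ⋯ ⊗ cₙ ⊗ w₋₁ ⊗ w₀`. -/
noncomputable def cobarTail (W : LeftComodule k C) :
    (n : ℕ) → (cobarObj W n →ₗ[k] C ⊗[k] cobarObj W n)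
  | 0 => W.coact
  | n + 1 => cobarStep (C := C) (Coalgebra.comul (R := k) (A := C)) (cobarTail W n)

/-- The cobar differential `V ⊗ C^{⊗ n} ⊗ W → V ⊗ C^{⊗ (n + 1)} ⊗ W`,
`v ⊗ c₁ ⊗ ⋯ ⊗ cₙ ⊗ w ↦ v₀ ⊗ v₁ ⊗ c₁ ⊗ ⋯ ⊗ w + ∑ᵢ (-1)^i v ⊗ ⋯ ⊗ Δ(cᵢ) ⊗ ⋯ ⊗ w
  + (-1)^(n + 1) v ⊗ c₁ ⊗ ⋯ ⊗ cₙ ⊗ w₋₁ ⊗ w₀`. -/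
noncomputable def cobarD (V : RightComodule k C) (W : LeftComodule k C) (n : ℕ) :
    V.carrier ⊗[k] cobarObj W n →ₗ[k] V.carrier ⊗[k] cobarObj W (n + 1) :=
  cobarStep V.coact (cobarTail W n)

lemma cobarStep_comp_cobarStep (V : RightComodule k C) {X : Type v} [AddCommGroup X] [Module k X]
    (δ : X →ₗ[k] C ⊗[k] X)
    (h : cobarStep (Coalgebra.comul (R := k) (A := C)) δ ∘ₗ δ = 0) :
    cobarStep V.coact (cobarStep (Coalgebra.comul (R := k) (A := C)) δ) ∘ₗ
      cobarStep V.coact δ = 0 := by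
  have e : ∀ (t : V.carrier ⊗[k] C) (x : X),
      TensorProduct.assoc k V.carrier C (C ⊗[k] X)
        ((LinearMap.rTensor (C ⊗[k] X) V.coact) (TensorProduct.assoc k V.carrier C X (t ⊗ₜ x)))
      = (TensorProduct.assoc k C C X).toLinearMap.lTensor V.carrier
          (TensorProduct.assoc k V.carrier (C ⊗[k] C) X
          ((TensorProduct.assoc k V.carrier C C (V.coact.rTensor C t)) ⊗ₜ x)) := by
    intro t x
    induction t with
    | zero => simp
    | add a b ha hb => simp only [TensorProduct.add_tmul, map_add, ha, hb]
    | tmul m c =>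
      simp only [TensorProduct.assoc_tmul, LinearMap.rTensor_tmul]
      generalize V.coact m = s
      induction s with
      | zero => simp
      | add a b ha hb => simp only [TensorProduct.add_tmul, map_add, ha, hb]
      | tmul m c => simp
  have e2 : ∀ (t : V.carrier ⊗[k] C) (x : X),
      (LinearMap.lTensor V.carrier (cobarStep (Coalgebra.comul (R := k) (A := C)) δ))
        (TensorProduct.assoc k V.carrier C X (t ⊗ₜ x))
      = (TensorProduct.assoc k C C X).toLinearMap.lTensor V.carrier
          (TensorProduct.assoc k V.carrier (C ⊗[k] C) X
          ((Coalgebra.comul.lTensor V.carrier t) ⊗ₜ x)) -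
        TensorProduct.assoc k V.carrier C (C ⊗[k] X) (t ⊗ₜ δ x) := by
    intro t x
    induction t with
    | zero => simp
    | add a b ha hb =>
      simp only [TensorProduct.add_tmul, map_add, ha, hb]
      abel
    | tmul m c => simp [cobarStep]
  ext m x
  have h1 := LinearMap.congr_fun V.coassoc m
  have h2 := LinearMap.congr_fun h x
  simp only [LinearMap.comp_apply, LinearEquiv.coe_coe] at h1 h2
  have e' := e (V.coact m) x
  rw [h1] at e'
  have e2' := e2 (V.coact m) x
  have h3 : (LinearMap.lTensor V.carrier (cobarStep (Coalgebra.comul (R := k) (A := C)) δ))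
      (m ⊗ₜ δ x) = 0 := by
    rw [LinearMap.lTensor_tmul, h2]; simp
  simp only [TensorProduct.AlgebraTensorModule.curry_apply, TensorProduct.curry_apply,
    LinearMap.restrictScalars_self, LinearMap.comp_apply, LinearMap.zero_apply]
  rw [show cobarStep V.coact δ (m ⊗ₜ x) =
    TensorProduct.assoc k V.carrier C X (V.coact m ⊗ₜ x) - m ⊗ₜ δ x by simp [cobarStep]]
  rw [cobarStep, LinearMap.sub_apply, map_sub, map_sub, h3, e2']
  simp only [LinearMap.comp_apply, LinearEquiv.coe_coe, e', LinearMap.rTensor_tmul]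
  abel

lemma cobarTail_comp_cobarTail (W : LeftComodule k C) (n : ℕ) :
    cobarStep (Coalgebra.comul (R := k) (A := C)) (cobarTail W n) ∘ₗ cobarTail W n = 0 := by
  induction n with
  | zero =>
    have h := W.coassoc
    simp only [cobarStep, cobarTail]
    exact sub_eq_zero.mpr h
  | succ n ih => exact cobarStep_comp_cobarStep (RightComodule.regular k C) _ ih

/-- The two-sided cobar complex `V ⊗ C^{⊗ *} ⊗ W`. -/
noncomputable def cobarComplex (V : RightComodule k C) (W : LeftComodule k C) :
    CochainComplex (ModuleCat.{v} k) ℕ :=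
  CochainComplex.of (fun n => ModuleCat.of k (V.carrier ⊗[k] cobarObj W n))
    (fun n => ModuleCat.ofHom (cobarD V W n))
    (fun n => ModuleCat.hom_ext
      (cobarStep_comp_cobarStep V (cobarTail W n) (cobarTail_comp_cobarTail W n)))

/-- `Cotor^n_C(V, W)`, the cohomology of the two-sided cobar complex. -/
noncomputable def Cotor (V : RightComodule k C) (W : LeftComodule k C) (n : ℕ) :
    ModuleCat.{v} k :=
  (cobarComplex V W).homology n

/-- A right comodule `P` is coflat if `Cotor^n_C(P, W) = 0` for all `n ≥ 1` and all left
comodules `W`. -/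
def RightComodule.Coflat (P : RightComodule k C) : Prop :=
  ∀ (W : LeftComodule k C) (n : ℕ), 1 ≤ n → Subsingleton (Cotor P W n)

/-- A left comodule `P` is coflat if `Cotor^n_C(V, P) = 0` for all `n ≥ 1` and all right
comodules `V`. -/
def LeftComodule.Coflat (P : LeftComodule k C) : Prop :=
  ∀ (V : RightComodule k C) (n : ℕ), 1 ≤ n → Subsingleton (Cotor V P n)

end Cobar

/-! ### Cotensor products -/

section Cotensor

variable {k : Type u} [Field k] {C D : Type v} [AddCommGroup C] [Module k C] [Coalgebra k C]
  [AddCommGroup D] [Module k D] [Coalgebra k D]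

/-- The map `V ⊗ W → V ⊗ (D ⊗ W)`, `v ⊗ w ↦ v₀ ⊗ v₁ ⊗ w - v ⊗ w₋₁ ⊗ w₀`. -/
noncomputable def cotensorMap (V : RightComodule k D) (W : LeftComodule k D) :
    V.carrier ⊗[k] W.carrier →ₗ[k] V.carrier ⊗[k] (D ⊗[k] W.carrier) :=
  cobarStep V.coact W.coact

/-- The cotensor product `V □_D W`, as a subspace of `V ⊗ W`. -/
noncomputable def cotensor (V : RightComodule k D) (W : LeftComodule k D) :
    Submodule k (V.carrier ⊗[k] W.carrier) :=
  LinearMap.ker (cotensorMap V W)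

/-- The left comodule `P ⊗ T`, with the coaction of `P`, for a left comodule `P` and a space `T`. -/
noncomputable abbrev LeftComodule.tensorRight (P : LeftComodule k D) (T : Type v) [AddCommGroup T]
    [Module k T] : LeftComodule k D where
  carrier := P.carrier ⊗[k] T
  coact := (TensorProduct.assoc k D P.carrier T).toLinearMap ∘ₗ P.coact.rTensor T
  coassoc := by
    ext p t
    have h := congrArg (fun z => (TensorProduct.assoc k D P.carrier T).toLinearMap.lTensor D
      (TensorProduct.assoc k D (D ⊗[k] P.carrier) T (z ⊗ₜ t))) (LinearMap.congr_fun P.coassoc p)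
    have e1 : ∀ s : D ⊗[k] P.carrier, (TensorProduct.assoc k D P.carrier T).toLinearMap.lTensor D
        (TensorProduct.assoc k D (D ⊗[k] P.carrier) T (TensorProduct.assoc k D D P.carrier
          ((Coalgebra.comul (R := k) (A := D)).rTensor P.carrier s) ⊗ₜ t)) =
        TensorProduct.assoc k D D (P.carrier ⊗[k] T)
          ((Coalgebra.comul (R := k) (A := D)).rTensor (P.carrier ⊗[k] T)
            (TensorProduct.assoc k D P.carrier T (s ⊗ₜ t))) := by
      intro s
      induction s with
      | zero => simp
      | add a b ha hb => simp only [TensorProduct.add_tmul, map_add, ha, hb]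
      | tmul d q =>
        simp only [TensorProduct.assoc_tmul, LinearMap.rTensor_tmul]
        generalize (Coalgebra.comul (R := k) d) = r
        induction r with
        | zero => simp
        | add a b ha hb => simp only [TensorProduct.add_tmul, map_add, ha, hb]
        | tmul d d' => simp
    have e2 : ∀ s : D ⊗[k] P.carrier, (TensorProduct.assoc k D P.carrier T).toLinearMap.lTensor D
        (TensorProduct.assoc k D (D ⊗[k] P.carrier) T (P.coact.lTensor D s ⊗ₜ t)) =
        ((TensorProduct.assoc k D P.carrier T).toLinearMap ∘ₗ P.coact.rTensor T).lTensor D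
            (TensorProduct.assoc k D P.carrier T (s ⊗ₜ t)) := by
      intro s
      induction s with
      | zero => simp
      | add a b ha hb => simp only [TensorProduct.add_tmul, map_add, ha, hb]
      | tmul d q => simp
    simp only [LinearMap.comp_apply, LinearEquiv.coe_coe] at h
    rw [e1, e2] at h
    simpa using h
  counit_coact := by
    ext p t
    have h := congrArg (fun z => TensorProduct.assoc k k P.carrier T (z ⊗ₜ t))
      (LinearMap.congr_fun P.counit_coact p)
    have e : ∀ s : D ⊗[k] P.carrier, TensorProduct.assoc k k P.carrier T
        ((Coalgebra.counit (R := k) (A := D)).rTensor P.carrier s ⊗ₜ t) =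
        (Coalgebra.counit (R := k) (A := D)).rTensor (P.carrier ⊗[k] T)
          (TensorProduct.assoc k D P.carrier T (s ⊗ₜ t)) := by
      intro s
      induction s with
      | zero => simp
      | add a b ha hb => simp only [TensorProduct.add_tmul, map_add, ha, hb]
      | tmul d q => simp
    simp only [LinearMap.comp_apply] at h
    rw [e] at h
    simpa using h

/-- The restriction of the coaction of a left comodule `W` to a subspace `S` whose elements have
their coaction in `D ⊗ S`; over a field `D ⊗ S → D ⊗ W` is injective. -/
noncomputable def LeftComodule.subCoact (W : LeftComodule k D) (S : Submodule k W.carrier)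
    (h : ∀ x ∈ S, W.coact x ∈ LinearMap.range (S.subtype.lTensor D)) : S →ₗ[k] D ⊗[k] S :=
  (LinearEquiv.ofInjective (S.subtype.lTensor D)
    (Module.Flat.lTensor_preserves_injective_linearMap S.subtype
      S.injective_subtype)).symm.toLinearMap ∘ₗ
    (W.coact.domRestrict S).codRestrict _ (fun x => h x x.2)

/-- The inclusion of the subspace commutes with the coactions. -/
lemma LeftComodule.subtype_subCoact (W : LeftComodule k D) (S : Submodule k W.carrier)
    (h : ∀ x ∈ S, W.coact x ∈ LinearMap.range (S.subtype.lTensor D)) :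
    S.subtype.lTensor D ∘ₗ W.subCoact S h = W.coact ∘ₗ S.subtype := by
  ext x
  have := congrArg Subtype.val ((LinearEquiv.ofInjective (S.subtype.lTensor D)
    (Module.Flat.lTensor_preserves_injective_linearMap S.subtype
      S.injective_subtype)).apply_symm_apply ((W.coact.domRestrict S).codRestrict _
        (fun x => h x x.2) x))
  exact this

lemma coassoc_of_injective (W : LeftComodule k D) {M : Type v} [AddCommGroup M] [Module k M]
    (i : M →ₗ[k] W.carrier) (hinj : Function.Injective i) (δ : M →ₗ[k] D ⊗[k] M)
    (hs : i.lTensor D ∘ₗ δ = W.coact ∘ₗ i) :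
    (TensorProduct.assoc k D D M).toLinearMap ∘ₗ
      (Coalgebra.comul (R := k) (A := D)).rTensor M ∘ₗ δ = δ.lTensor D ∘ₗ δ := by
  have hi : Function.Injective ((i.lTensor D).lTensor D) :=
    Module.Flat.lTensor_preserves_injective_linearMap _
      (Module.Flat.lTensor_preserves_injective_linearMap i hinj)
  have e : (i.lTensor D).lTensor D ∘ₗ (TensorProduct.assoc k D D M).toLinearMap ∘ₗ
      (Coalgebra.comul (R := k) (A := D)).rTensor M =
      (TensorProduct.assoc k D D W.carrier).toLinearMap ∘ₗ
      (Coalgebra.comul (R := k) (A := D)).rTensor W.carrier ∘ₗ i.lTensor D := by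
    ext d x
    simp only [TensorProduct.AlgebraTensorModule.curry_apply, TensorProduct.curry_apply,
      LinearMap.restrictScalars_self, LinearMap.comp_apply, LinearMap.rTensor_tmul,
      LinearMap.lTensor_tmul, LinearEquiv.coe_coe]
    generalize (Coalgebra.comul (R := k) d) = r
    induction r with
    | zero => simp
    | add a b ha hb => simp only [TensorProduct.add_tmul, map_add, ha, hb]
    | tmul d d' => simp
  ext x
  apply hi
  have h1 := LinearMap.congr_fun e (δ x)
  have h2 := LinearMap.congr_fun hs x
  have h3 := LinearMap.congr_fun W.coassoc (i x)
  have h4 := LinearMap.congr_fun (congrArg (LinearMap.lTensor D) hs) (δ x)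
  simp only [LinearMap.comp_apply, LinearMap.lTensor_comp] at h1 h2 h3 h4 ⊢
  rw [h1, h2, h3, h4, h2]

lemma counit_of_injective (W : LeftComodule k D) {M : Type v} [AddCommGroup M] [Module k M]
    (i : M →ₗ[k] W.carrier) (hinj : Function.Injective i) (δ : M →ₗ[k] D ⊗[k] M)
    (hs : i.lTensor D ∘ₗ δ = W.coact ∘ₗ i) :
    (Coalgebra.counit (R := k) (A := D)).rTensor M ∘ₗ δ = TensorProduct.mk k k M 1 := by
  have hi : Function.Injective (i.lTensor k) :=
    Module.Flat.lTensor_preserves_injective_linearMap i hinj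
  ext x
  apply hi
  have h2 := LinearMap.congr_fun hs x
  have h3 := LinearMap.congr_fun W.counit_coact (i x)
  have h1 : i.lTensor k ∘ₗ (Coalgebra.counit (R := k) (A := D)).rTensor M =
      (Coalgebra.counit (R := k) (A := D)).rTensor W.carrier ∘ₗ i.lTensor D := by
    ext; simp
  have h1 := LinearMap.congr_fun h1 (δ x)
  simp only [LinearMap.comp_apply] at h1 h2 h3 ⊢
  rw [h1, h2, h3]
  simp

/-- A subspace `S` of a left comodule whose elements have their coaction in `D ⊗ S`, as a left
comodule with the restricted coaction. -/
noncomputable def LeftComodule.sub (W : LeftComodule k D) (S : Submodule k W.carrier)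
    (h : ∀ x ∈ S, W.coact x ∈ LinearMap.range (S.subtype.lTensor D)) : LeftComodule k D where
  carrier := S
  coact := W.subCoact S h
  coassoc := coassoc_of_injective W S.subtype S.injective_subtype _ (W.subtype_subCoact S h)
  counit_coact := counit_of_injective W S.subtype S.injective_subtype _ (W.subtype_subCoact S h)

/-- If `P` is a left and a right `D`-comodule with commuting coactions (a bicomodule), then
`P □_D T` is stable under the left coaction of `P ⊗ T`. -/
lemma cotensor_stable (P : LeftComodule k D) (ρ : P.carrier →ₗ[k] P.carrier ⊗[k] D)
    (h : (TensorProduct.assoc k D P.carrier D).toLinearMap ∘ₗ P.coact.rTensor D ∘ₗ ρ =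
      ρ.lTensor D ∘ₗ P.coact) (T : LeftComodule k D) (x : P.carrier ⊗[k] T.carrier)
    (hx : x ∈ LinearMap.ker (cobarStep ρ T.coact)) :
    (P.tensorRight T.carrier).coact x ∈
      LinearMap.range ((LinearMap.ker (cobarStep ρ T.coact)).subtype.lTensor D) := by
  have ex := Module.Flat.lTensor_exact D (LinearMap.exact_subtype_ker_map (cobarStep ρ T.coact))
  refine (ex _).mp ?_
  have comm : (cobarStep ρ T.coact).lTensor D ∘ₗ (P.tensorRight T.carrier).coact =
      (P.tensorRight (D ⊗[k] T.carrier)).coact ∘ₗ cobarStep ρ T.coact := by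
    have e1 : ∀ (s : P.carrier ⊗[k] D) (t : T.carrier),
        (P.tensorRight (D ⊗[k] T.carrier)).coact (TensorProduct.assoc k P.carrier D T.carrier
          (s ⊗ₜ t)) =
        (TensorProduct.assoc k P.carrier D T.carrier).toLinearMap.lTensor D
          (TensorProduct.assoc k D (P.carrier ⊗[k] D) T.carrier
            (TensorProduct.assoc k D P.carrier D (P.coact.rTensor D s) ⊗ₜ t)) := by
      intro s t
      induction s with
      | zero => simp
      | add a b ha hb => simp only [TensorProduct.add_tmul, map_add, ha, hb]
      | tmul p d =>
        simp only [LinearMap.comp_apply, TensorProduct.assoc_tmul, LinearMap.rTensor_tmul,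
          LinearEquiv.coe_coe]
        generalize P.coact p = r
        induction r with
        | zero => simp
        | add a b ha hb => simp only [TensorProduct.add_tmul, map_add, ha, hb]
        | tmul d d' => simp
    have e2 : ∀ (s : D ⊗[k] P.carrier) (t : T.carrier),
        (cobarStep ρ T.coact).lTensor D (TensorProduct.assoc k D P.carrier T.carrier (s ⊗ₜ t)) =
        (TensorProduct.assoc k P.carrier D T.carrier).toLinearMap.lTensor D
          (TensorProduct.assoc k D (P.carrier ⊗[k] D) T.carrier (ρ.lTensor D s ⊗ₜ t)) -
        TensorProduct.assoc k D P.carrier (D ⊗[k] T.carrier) (s ⊗ₜ T.coact t) := by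
      intro s t
      induction s with
      | zero => simp
      | add a b ha hb =>
        simp only [TensorProduct.add_tmul, map_add, ha, hb]
        abel
      | tmul d p => simp [cobarStep]
    ext p t
    have h1 := LinearMap.congr_fun h p
    have h2 := e1 (ρ p) t
    have h3 := e2 (P.coact p) t
    simp only [LinearMap.comp_apply, LinearEquiv.coe_coe] at h1 h2
    rw [h1] at h2
    simp only [TensorProduct.AlgebraTensorModule.curry_apply, TensorProduct.curry_apply,
      LinearMap.restrictScalars_self, LinearMap.comp_apply, LinearMap.rTensor_tmul,
      LinearEquiv.coe_coe]
    rw [h3]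
    rw [show cobarStep ρ T.coact (p ⊗ₜ t) = TensorProduct.assoc k P.carrier D T.carrier
      (ρ p ⊗ₜ t) - p ⊗ₜ T.coact t by simp [cobarStep]]
    rw [map_sub, map_sub, h2]
    simp
  have := LinearMap.congr_fun comm x
  exact this.trans ((congrArg (P.tensorRight (D ⊗[k] T.carrier)).coact hx).trans (map_zero _))

/-- The left and right coactions of `D` on `C` induced by `π : C → D` commute. -/
lemma regular_corestrict_comm (π : C →ₗc[k] D) :
    (TensorProduct.assoc k D C D).toLinearMap ∘ₗ
      ((LeftComodule.regular k C).corestrict π).coact.rTensor D ∘ₗ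
      ((RightComodule.regular k C).corestrict π).coact =
    (((RightComodule.regular k C).corestrict π).coact).lTensor D ∘ₗ
      ((LeftComodule.regular k C).corestrict π).coact := by
  have e1 : ∀ s : C ⊗[k] C, TensorProduct.assoc k D C D
      ((π.toLinearMap.rTensor C ∘ₗ Coalgebra.comul).rTensor D (π.toLinearMap.lTensor C s)) =
      TensorProduct.map π.toLinearMap (π.toLinearMap.lTensor C)
        (TensorProduct.assoc k C C C (Coalgebra.comul.rTensor C s)) := by
    intro s
    induction s with
    | zero => simp
    | add a b ha hb => simp only [map_add, ha, hb]
    | tmul a b =>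
      simp only [LinearMap.lTensor_tmul, LinearMap.rTensor_tmul, LinearMap.comp_apply]
      generalize (Coalgebra.comul (R := k) a) = r
      induction r with
      | zero => simp
      | add a b ha hb => simp only [TensorProduct.add_tmul, map_add, ha, hb]
      | tmul d d' => simp
  have e2 : ∀ s : C ⊗[k] C,
      (π.toLinearMap.lTensor C ∘ₗ Coalgebra.comul).lTensor D (π.toLinearMap.rTensor C s) =
      TensorProduct.map π.toLinearMap (π.toLinearMap.lTensor C)
        (Coalgebra.comul.lTensor C s) := by
    intro s
    induction s with
    | zero => simp
    | add a b ha hb => simp only [map_add, ha, hb]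
    | tmul a b => simp
  refine LinearMap.ext fun c => ?_
  refine (e1 (Coalgebra.comul c)).trans (Eq.trans ?_ (e2 (Coalgebra.comul c)).symm)
  exact congrArg _ (Coalgebra.coassoc_apply (R := k) (A := C) c)

/-- For a coalgebra map `π : C → D` and a left `D`-comodule `T`, the cotensor product `C □_D T`
as a left `D`-comodule with the coaction `c ⊗ t ↦ π(c₁) ⊗ (c₂ ⊗ t)`. -/
noncomputable def cotensorComodule (π : C →ₗc[k] D) (T : LeftComodule k D) : LeftComodule k D :=
  LeftComodule.sub (((LeftComodule.regular k C).corestrict π).tensorRight T.carrier)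
    (cotensor ((RightComodule.regular k C).corestrict π) T)
    (cotensor_stable ((LeftComodule.regular k C).corestrict π)
      ((RightComodule.regular k C).corestrict π).coact (regular_corestrict_comm π) T)

/-- The left `D`-comodule `C^{□_D i} □_D T = C □_D (C □_D (⋯ □_D (C □_D T)))`. -/
noncomputable def cotensorPower (π : C →ₗc[k] D) (T : LeftComodule k D) : ℕ → LeftComodule k D
  | 0 => T
  | i + 1 => cotensorComodule π (cotensorPower π T i)

end Cotensor

/-! ### Convergence of first quadrant spectral sequences -/

section Convergence

open CategoryTheory

variable {k : Type u} [Field k]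

/-- A first quadrant cohomological spectral sequence of `k`-vector spaces starting with `E_1`
converges to `H^*` if every `H^n` has a decreasing filtration
`H^n = F^0 H^n ⊇ F^1 H^n ⊇ ⋯ ⊇ F^(n+1) H^n = 0` with `F^p H^(p+q) / F^(p+1) H^(p+q)` isomorphic to
`E_∞^{p,q}`. The latter is `E_r^{p,q}` for any `r > max (p, q + 1)`, because for such `r` the
differentials `d_r` from and to the position `(p, q)` leave the first quadrant. -/
def ConvergesTo (E : CohomologicalSpectralSequenceNat (ModuleCat.{v} k) 1)
    (H : ℕ → ModuleCat.{v} k) : Prop :=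
  ∃ F : (n : ℕ) → ℕ → Submodule k (H n),
    (∀ n, Antitone (F n)) ∧ (∀ n, F n 0 = ⊤) ∧ (∀ n, F n (n + 1) = ⊥) ∧
    ∀ (p q : ℕ) (r : ℤ) (hr : 1 ≤ r), (p : ℤ) < r → (q : ℤ) + 1 < r →
      Nonempty ((E.page r hr).X (p, q) ≃ₗ[k]
        (F (p + q) p ⧸ (F (p + q) (p + 1)).submoduleOf (F (p + q) p)))

end Convergence

/-! Write `G P = C □_D P` for a left `C`-comodule `P`. The coaction gives a colinear natural map `P
→ G P`, and its alternating combinations form the relative cobar resolution `W → G W → G G W → ⋯` of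
`C`-comodules. It is exact because the counit of `C` on the first factor is a `k`-linear contraction
(`exact_relStep`). Over a field the cobar construction `V ⊗ C^{⊗ n} ⊗ -` is exact, so the resolution
becomes an exact sequence of cobar complexes. Cutting this sequence into short exact ones and taking
cohomology gives an exact couple; its spectral sequence converges to `Cotor_C(V, W)`, with
`E_1^{i,j} = Cotor_C^j(V, G (G^i W))`.

It remains to see that `Cotor_C(V, C □_D T) ≅ Cotor_D(V, T)` (`nonempty_cotor_coinduced_equiv`), and
this is where coflatness enters. The complex `C ⊗ T → C ⊗ D ⊗ T → ⋯` is the cobar complex of `C` and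
`T` over `D`, so vanishing of `Cotor_D^n(C, T)` for `n ≥ 1` makes it a resolution of `C □_D T` by
cofree `C`-comodules. A cofree comodule `C ⊗ X` has no higher `Cotor` (`subsingleton_cotor_cofree`),
and `Cotor_C^0(V, C ⊗ X)` is `V ⊗ X`. Hence `Cotor_C(V, C □_D T)` is the cohomology of the complex
of the `V ⊗ D^{⊗ b} ⊗ T`, which is the cobar complex over `D` (`cobarStep_zero_comp_cobarStep`).

Both halves use the same dimension-shifting framework, `SyzygySequence`. -/

open CategoryTheory Limits

/-! ### Exact couples: cycles, boundaries and differentials of the pages. -/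

/-- The long exact sequences of a decreasing filtration: `D n p` is the cohomology of degree `n`
of the `p`-th step, `E n p` that of the `p`-th graded piece. -/
structure FilteredCouple (k : Type u) [Field k] where
  D : ℕ → ℕ → ModuleCat.{v} k
  E : ℕ → ℕ → ModuleCat.{v} k
  c (n p : ℕ) : D n (p + 1) →ₗ[k] D n p
  a (n p : ℕ) : D n p →ₗ[k] E n p
  b (n p : ℕ) : E n p →ₗ[k] D (n + 1) (p + 1)
  exact_c_a (n p : ℕ) : Function.Exact (c n p) (a n p)
  exact_a_b (n p : ℕ) : Function.Exact (a n p) (b n p)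
  exact_b_c (n p : ℕ) : Function.Exact (b n p) (c (n + 1) p)
  subsingleton_D (n p : ℕ) (h : n < p) : Subsingleton (D n p)

namespace FilteredCouple

variable {k : Type u} [Field k] (S : FilteredCouple.{u, v} k)

/-- The `m`-fold iterate of `c`. -/
def iter (n p : ℕ) : (m : ℕ) → (S.D n (p + m) →ₗ[k] S.D n p)
  | 0 => LinearMap.id
  | m + 1 => iter n p m ∘ₗ S.c n (p + m)

/-- The iterate of `c` down to filtration degree zero. -/
def toZero (n : ℕ) : (p : ℕ) → (S.D n p →ₗ[k] S.D n 0)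
  | 0 => LinearMap.id
  | p + 1 => toZero n p ∘ₗ S.c n p

/-- The kernel of the `m`-fold iterate of `c`, or of the `p`-fold one if `p < m`. -/
def iterKer (n : ℕ) : (m p : ℕ) → Submodule k (S.D n p)
  | 0, _ => ⊥
  | _ + 1, 0 => ⊥
  | m + 1, p + 1 => (iterKer n m p).comap (S.c n p)

lemma iterKer_add (n p m : ℕ) : S.iterKer n m (p + m) = LinearMap.ker (S.iter n p m) := by
  induction m with
  | zero => exact LinearMap.ker_id.symm
  | succ m ih => exact (congrArg (Submodule.comap (S.c n (p + m))) ih)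

/-- `iter` peels off the map `c` at the top of the tower; here the last map `c` at the bottom is
split off, which is the one that meets `b`. -/
lemma mem_iterKer_succ (n p m : ℕ) (x : S.D n (p + 1 + m)) :
    x ∈ S.iterKer n (m + 1) (p + 1 + m) ↔ S.c n p (S.iter n (p + 1) m x) = 0 := by
  induction m with
  | zero => exact Iff.rfl
  | succ m ih => exact ih (S.c n (p + 1 + m) x)

/-- Filtration degree zero is reached after `p` steps, so further steps add nothing to the kernel.
This is why boundaries stabilise. -/
lemma iterKer_succ_of_le (n : ℕ) {m p : ℕ} (h : p ≤ m) :
    S.iterKer n (m + 1) p = S.iterKer n m p := by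
  induction m generalizing p with
  | zero =>
    obtain rfl : p = 0 := by omega
    rfl
  | succ m ih =>
    cases p with
    | zero => rfl
    | succ p => exact congrArg (Submodule.comap (S.c n p)) (ih (by omega))

lemma iterKer_of_le (n : ℕ) {m p : ℕ} (h : p ≤ m) :
    S.iterKer n m p = LinearMap.ker (S.toZero n p) := by
  induction m generalizing p with
  | zero =>
    obtain rfl : p = 0 := by omega
    exact LinearMap.ker_id.symm
  | succ m ih =>
    cases p with
    | zero => exact LinearMap.ker_id.symm
    | succ p => exact congrArg (Submodule.comap (S.c n p)) (ih (by omega))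

/-- The cycles `Z_{m + 1}`. -/
def Z (m n p : ℕ) : Submodule k (S.E n p) :=
  (LinearMap.range (S.iter (n + 1) (p + 1) m)).comap (S.b n p)

/-- The boundaries `B_{m + 1}`. -/
def B (m n p : ℕ) : Submodule k (S.E n p) := (S.iterKer n m p).map (S.a n p)

lemma b_a (n p : ℕ) (x : S.D n p) : S.b n p (S.a n p x) = 0 :=
  (S.exact_a_b n p).apply_apply_eq_zero x

lemma c_b (n p : ℕ) (x : S.E n p) : S.c (n + 1) p (S.b n p x) = 0 :=
  (S.exact_b_c n p).apply_apply_eq_zero x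

lemma a_c (n p : ℕ) (x : S.D n (p + 1)) : S.a n p (S.c n p x) = 0 :=
  (S.exact_c_a n p).apply_apply_eq_zero x

lemma a_mem_Z (m n p : ℕ) (x : S.D n p) : S.a n p x ∈ S.Z m n p := by
  simp [Z, b_a]

lemma Z_succ_le (m n p : ℕ) : S.Z (m + 1) n p ≤ S.Z m n p := by
  rintro x ⟨u, hu⟩
  exact ⟨S.c _ _ u, hu⟩

/-- Then `D (n + 1) (p + 1 + m)` vanishes, so the cycles are permanent. This is why cycles
stabilise. -/
lemma Z_of_lt {m n p : ℕ} (h : n < p + m) : S.Z m n p = LinearMap.ker (S.b n p) := by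
  have := S.subsingleton_D (n + 1) (p + 1 + m) (by omega)
  ext x
  refine ⟨?_, fun hx => ⟨0, ?_⟩⟩
  · rintro ⟨u, hu⟩
    rw [Subsingleton.elim u 0, map_zero] at hu
    exact hu.symm
  · rw [map_zero]
    exact hx.symm

/-- The terms of the page `E_{m + 1}`. -/
abbrev Page (m n p : ℕ) : Type v := S.Z m n p ⧸ (S.B m n p).submoduleOf (S.Z m n p)

/-- The differential is `a ∘ c^{-m} ∘ b`. A linear section of `c^m` onto its image exists over a
field; two lifts differ by an element of `ker c^m`, whose image under `a` is a boundary. Boundaries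
are sent to zero because `b ∘ a = 0` allows the lift `0`. -/
lemma exists_d (m n p : ℕ) :
    ∃ f : S.Page m n p →ₗ[k] S.Page m (n + 1) (p + 1 + m),
      ∀ (x : S.Z m n p) (w : S.D (n + 1) (p + 1 + m)), S.iter (n + 1) (p + 1) m w = S.b n p x →
        f (Submodule.Quotient.mk x) = Submodule.Quotient.mk ⟨S.a _ _ w, S.a_mem_Z m _ _ w⟩ := by
  obtain ⟨φ, hφ⟩ := (S.iter (n + 1) (p + 1) m).rangeRestrict.exists_rightInverse_of_surjective
    (LinearMap.range_rangeRestrict _)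
  have hφ' : ∀ y, S.iter (n + 1) (p + 1) m (φ y) = y := fun y =>
    congrArg Subtype.val (LinearMap.congr_fun hφ y)
  let b' : S.Z m n p →ₗ[k] LinearMap.range (S.iter (n + 1) (p + 1) m) :=
    ((S.b n p).domRestrict _).codRestrict _ fun x => x.2
  let a' : S.D (n + 1) (p + 1 + m) →ₗ[k] S.Z m (n + 1) (p + 1 + m) :=
    (S.a _ _).codRestrict _ fun x => S.a_mem_Z m _ _ x
  let g : S.Z m n p →ₗ[k] S.Page m (n + 1) (p + 1 + m) := Submodule.mkQ _ ∘ₗ a' ∘ₗ φ ∘ₗ b'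
  have hg : ∀ (x : S.Z m n p) (w : S.D (n + 1) (p + 1 + m)),
      S.iter (n + 1) (p + 1) m w = S.b n p x → g x = Submodule.Quotient.mk (a' w) := by
    intro x w hw
    refine (Submodule.Quotient.eq _).mpr ⟨φ (b' x) - w, ?_, map_sub _ _ _⟩
    rw [iterKer_add]
    simp only [SetLike.mem_coe, LinearMap.mem_ker, map_sub, hφ', hw]
    exact sub_self _
  refine ⟨Submodule.liftQ _ g ?_, fun x w hw => hg x w hw⟩
  rintro ⟨x, hx⟩ ⟨w, -, rfl⟩
  refine (hg _ 0 ?_).trans ?_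
  · exact (map_zero _).trans (S.b_a n p w).symm
  · rw [map_zero]; rfl

/-- The differential of the page `E_{m + 1}`. -/
noncomputable def d (m n p : ℕ) : S.Page m n p →ₗ[k] S.Page m (n + 1) (p + 1 + m) :=
  (S.exists_d m n p).choose

lemma d_mk (m n p : ℕ) (x : S.Z m n p) (w : S.D (n + 1) (p + 1 + m))
    (hw : S.iter (n + 1) (p + 1) m w = S.b n p x) :
    S.d m n p (Submodule.Quotient.mk x) = Submodule.Quotient.mk ⟨S.a _ _ w, S.a_mem_Z m _ _ w⟩ :=
  (S.exists_d m n p).choose_spec x w hw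

/-- If `a w = a w'` with `c^m w' = 0`, then `w - w'` lies in `ker a = range c` and is still a lift
of `b x`; so `b x` lifts one step further. -/
lemma d_mk_eq_zero_iff (m n p : ℕ) (x : S.Z m n p) :
    S.d m n p (Submodule.Quotient.mk x) = 0 ↔ (x : S.E n p) ∈ S.Z (m + 1) n p := by
  obtain ⟨w, hw⟩ := x.2
  rw [S.d_mk m n p x w hw, Submodule.Quotient.mk_eq_zero]
  constructor
  · rintro ⟨w', hw', h⟩
    rw [iterKer_add] at hw'
    have h' : S.a _ _ (w - w') = 0 := by
      rw [map_sub, sub_eq_zero]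
      exact h.symm
    obtain ⟨t, ht⟩ := (S.exact_c_a _ _ _).mp h'
    refine ⟨t, ?_⟩
    change S.iter (n + 1) (p + 1) m (S.c (n + 1) (p + 1 + m) t) = _
    rw [ht, map_sub, LinearMap.mem_ker.mp hw', sub_zero, hw]
  · rintro ⟨t, ht⟩
    change S.iter (n + 1) (p + 1) m (S.c _ _ t) = _ at ht
    refine ⟨w - S.c (n + 1) (p + 1 + m) t, ?_, ?_⟩
    · rw [iterKer_add]
      simp only [SetLike.mem_coe, LinearMap.mem_ker, map_sub, hw, ht, sub_self]
    · rw [map_sub, a_c, sub_zero]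
      rfl

/-- The values `a w` of the differential come from those `w` with `c^m w` in `range b = ker c`, that
is with `c^{m+1} w = 0`. -/
lemma mk_mem_range_d_iff (m n p : ℕ) (y : S.Z m (n + 1) (p + 1 + m)) :
    Submodule.Quotient.mk y ∈ LinearMap.range (S.d m n p) ↔
      (y : S.E (n + 1) (p + 1 + m)) ∈ S.B (m + 1) (n + 1) (p + 1 + m) := by
  constructor
  · rintro ⟨x, hx⟩
    obtain ⟨x, rfl⟩ := Submodule.Quotient.mk_surjective _ x
    obtain ⟨w, hw⟩ := x.2
    rw [S.d_mk m n p x w hw, eq_comm, Submodule.Quotient.eq] at hx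
    obtain ⟨w', hw', h⟩ := hx
    refine ⟨w' + w, ?_, ?_⟩
    · refine (S.mem_iterKer_succ _ _ _ _).mpr ?_
      rw [iterKer_add] at hw'
      rw [map_add, LinearMap.mem_ker.mp hw', hw, zero_add, c_b]
    · rw [map_add, h]
      exact sub_add_cancel _ _
  · rintro ⟨w, hw, h⟩
    have hw' := (S.mem_iterKer_succ _ _ _ _).mp hw
    obtain ⟨x, hx⟩ := (S.exact_b_c _ _ _).mp hw'
    refine ⟨Submodule.Quotient.mk ⟨x, w, hx.symm⟩, (S.d_mk m n p _ w hx.symm).trans ?_⟩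
    congr 1
    exact Subtype.ext h

lemma d_comp_d (m n p : ℕ) : S.d m (n + 1) (p + 1 + m) ∘ₗ S.d m n p = 0 := by
  ext x
  obtain ⟨w, hw⟩ := x.2
  simp only [LinearMap.comp_apply, Submodule.mkQ_apply, LinearMap.zero_apply]
  rw [S.d_mk m n p x w hw, d_mk_eq_zero_iff]
  exact S.a_mem_Z _ _ _ _

end FilteredCouple

/-- Homology is computed from any map onto the cycles, modulo the preimage of the boundaries; no
subquotient of a subquotient has to be formed. -/
lemma CategoryTheory.ShortComplex.nonempty_homology_equiv {k : Type u} [Field k]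
    (S : ShortComplex (ModuleCat.{v} k)) {A : Type v} [AddCommGroup A] [Module k A]
    (ψ : A →ₗ[k] S.X₂) (hψ : LinearMap.range ψ = LinearMap.ker S.g.hom) (N : Submodule k A)
    (hN : ∀ x, x ∈ N ↔ ψ x ∈ LinearMap.range S.f.hom) :
    Nonempty (S.homology ≃ₗ[k] (A ⧸ N)) := by
  let ψ' : A →ₗ[k] LinearMap.ker S.g.hom :=
    ψ.codRestrict _ fun x => hψ ▸ LinearMap.mem_range_self ψ x
  let χ : A →ₗ[k] S.moduleCatLeftHomologyData.H := (Submodule.mkQ _) ∘ₗ ψ'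
  have hχ : Function.Surjective χ := by
    refine (Submodule.mkQ_surjective _).comp ?_
    rintro ⟨y, hy⟩
    obtain ⟨x, rfl⟩ : y ∈ LinearMap.range ψ := hψ ▸ hy
    exact ⟨x, rfl⟩
  have hker : LinearMap.ker χ = N := by
    ext x
    rw [hN, LinearMap.mem_ker]
    refine (Submodule.Quotient.mk_eq_zero _).trans ?_
    constructor
    · rintro ⟨y, hy⟩
      exact ⟨y, congrArg Subtype.val hy⟩
    · rintro ⟨y, hy⟩
      exact ⟨y, Subtype.ext hy⟩
  exact ⟨S.moduleCatHomologyIso.toLinearEquiv.trans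
    ((Submodule.quotEquivOfEq _ _ hker).symm.trans (χ.quotKerEquivOfSurjective hχ)).symm⟩

/-- The right-hand side is symmetric in `a` and `t`. Applied in both orders, this identifies `E_∞`,
which is `range a` modulo `a (ker t)`, with the graded piece `range t` modulo `t (ker a)`. -/
lemma nonempty_range_quotient_equiv {k : Type u} [Field k] {D E H : Type v} [AddCommGroup D]
    [Module k D] [AddCommGroup E] [Module k E] [AddCommGroup H] [Module k H]
    (a : D →ₗ[k] E) (t : D →ₗ[k] H) (P : Submodule k E) (hP : P = LinearMap.range a)
    (N : Submodule k E) (hN : N = (LinearMap.ker t).map a) :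
    Nonempty ((P ⧸ N.submoduleOf P) ≃ₗ[k]
      (D ⧸ (LinearMap.ker a ⊔ LinearMap.ker t))) := by
  subst hP hN
  let χ : D →ₗ[k] (LinearMap.range a ⧸
      ((LinearMap.ker t).map a).submoduleOf (LinearMap.range a)) :=
    Submodule.mkQ _ ∘ₗ a.rangeRestrict
  have hχ : Function.Surjective χ :=
    (Submodule.mkQ_surjective _).comp a.surjective_rangeRestrict
  have hker : LinearMap.ker χ = LinearMap.ker a ⊔ LinearMap.ker t := by
    ext x
    refine (Submodule.Quotient.mk_eq_zero _).trans ?_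
    rw [sup_comm, ← Submodule.comap_map_eq]
    rfl
  exact ⟨((Submodule.quotEquivOfEq _ _ hker).symm.trans (χ.quotKerEquivOfSurjective hχ)).symm⟩

/-! ### The spectral sequence of an exact couple and its convergence. -/

namespace FilteredCouple

variable {k : Type u} [Field k] (S : FilteredCouple.{u, v} k)

/-- The differential of the page `E_{m + 1}`, with target given up to equality of indices. -/
noncomputable def dTo (m : ℕ) {n p n' p' : ℕ} (hn : n + 1 = n') (hp : p + 1 + m = p') :
    S.Page m n p →ₗ[k] S.Page m n' p' :=
  hn ▸ hp ▸ S.d m n p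

lemma dTo_mk_eq_zero_iff (m : ℕ) {n p n' p' : ℕ} (hn : n + 1 = n') (hp : p + 1 + m = p')
    (x : S.Z m n p) :
    S.dTo m hn hp (Submodule.Quotient.mk x) = 0 ↔ (x : S.E n p) ∈ S.Z (m + 1) n p := by
  subst hn hp
  exact S.d_mk_eq_zero_iff m n p x

lemma mk_mem_range_dTo_iff (m : ℕ) {n p n' p' : ℕ} (hn : n + 1 = n') (hp : p + 1 + m = p')
    (y : S.Z m n' p') :
    Submodule.Quotient.mk y ∈ LinearMap.range (S.dTo m hn hp) ↔
      (y : S.E n' p') ∈ S.B (m + 1) n' p' := by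
  subst hn hp
  exact S.mk_mem_range_d_iff m n p y

lemma dTo_comp_dTo (m : ℕ) {n p n' p' n'' p'' : ℕ} (hn : n + 1 = n') (hp : p + 1 + m = p')
    (hn' : n' + 1 = n'') (hp' : p' + 1 + m = p'') :
    S.dTo m hn' hp' ∘ₗ S.dTo m hn hp = 0 := by
  subst hn hp hn' hp'
  exact S.d_comp_d m n p

open Classical in
/-- The page `E_{m + 1}`, with differentials of bidegree `(r, 1 - r)` where `r = m + 1`. -/
noncomputable def pageComplex (m : ℕ) (r : ℤ) (hr : r = m + 1) :
    HomologicalComplex (ModuleCat.{v} k) (ComplexShape.spectralSequenceNat ⟨r, 1 - r⟩) where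
  X pq := ModuleCat.of k (S.Page m (pq.1 + pq.2) pq.1)
  d pq pq' := if h : (ComplexShape.spectralSequenceNat ⟨r, 1 - r⟩).Rel pq pq' then
    ModuleCat.ofHom (S.dTo m (by have := h.1; have := h.2; dsimp only at *; omega)
      (by have := h.1; dsimp only at *; omega)) else 0
  shape pq pq' h := dif_neg h
  d_comp_d' pq pq' pq'' h h' := by
    rw [dif_pos h, dif_pos h', ← ModuleCat.ofHom_comp, dTo_comp_dTo]
    rfl

lemma pageComplex_d (m : ℕ) (r : ℤ) (hr : r = m + 1) {pq pq' : ℕ × ℕ}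
    (h : (ComplexShape.spectralSequenceNat ⟨r, 1 - r⟩).Rel pq pq')
    (hn : pq.1 + pq.2 + 1 = pq'.1 + pq'.2) (hp : pq.1 + 1 + m = pq'.1) :
    (S.pageComplex m r hr).d pq pq' = ModuleCat.ofHom (S.dTo m hn hp) := dif_pos h

lemma nonempty_pageComplex_homology (m : ℕ) (r r' : ℤ) (hr : r = m + 1)
    (hr' : r' = (m + 1 : ℕ) + 1) (pq : ℕ × ℕ) :
    Nonempty ((S.pageComplex m r hr).homology pq ≅ (S.pageComplex (m + 1) r' hr').X pq) := by
  let c := ComplexShape.spectralSequenceNat ⟨r, 1 - r⟩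
  let K := S.pageComplex m r hr
  let n := pq.1 + pq.2
  let ψ : S.Z (m + 1) n pq.1 →ₗ[k] S.Page m n pq.1 :=
    Submodule.mkQ _ ∘ₗ Submodule.inclusion (S.Z_succ_le m n pq.1)
  have hout : ∀ x : S.Z m n pq.1, (K.d pq (c.next pq)).hom (Submodule.Quotient.mk x) = 0 ↔
      (x : S.E n pq.1) ∈ S.Z (m + 1) n pq.1 := by
    intro x
    by_cases h : c.Rel pq (c.next pq)
    · have h1 := h.1
      have h2 := h.2
      dsimp only at h1 h2
      rw [S.pageComplex_d m r hr h (by omega) (by omega)]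
      exact S.dTo_mk_eq_zero_iff _ _ _ _
    · rw [K.shape _ _ h]
      -- No outgoing arrow means that its target would lie below the first quadrant; in this range
      -- the cycles have already stabilised.
      have hlt : pq.2 < m := by
        by_contra hge
        have hrel : c.Rel pq (pq.1 + 1 + m, pq.2 - m) := by
          constructor <;> dsimp only <;> omega
        exact h (by rwa [c.next_eq' hrel])
      have hx := x.2
      have hZ : S.Z m n pq.1 = S.Z (m + 1) n pq.1 := by
        rw [S.Z_of_lt (by omega), S.Z_of_lt (by omega)]
      exact iff_of_true rfl (hZ ▸ hx)
  have hin : ∀ x : S.Z m n pq.1,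
      Submodule.Quotient.mk x ∈ LinearMap.range (K.d (c.prev pq) pq).hom ↔
      (x : S.E n pq.1) ∈ S.B (m + 1) n pq.1 := by
    intro x
    by_cases h : c.Rel (c.prev pq) pq
    · have h1 := h.1
      have h2 := h.2
      dsimp only at h1 h2
      rw [S.pageComplex_d m r hr h (by omega) (by omega)]
      exact S.mk_mem_range_dTo_iff _ _ _ _
    · rw [K.shape _ _ h]
      -- No incoming arrow means that its source would lie left of the first quadrant; there the
      -- boundaries have already stabilised.
      have hlt : pq.1 ≤ m := by
        by_contra hge
        have hrel : c.Rel (pq.1 - (m + 1), pq.2 + m) pq := by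
          constructor <;> dsimp only <;> omega
        exact h (by rwa [c.prev_eq' hrel])
      have hB : S.B (m + 1) n pq.1 = S.B m n pq.1 :=
        congrArg (Submodule.map _) (S.iterKer_succ_of_le n hlt)
      rw [hB]
      refine Iff.trans ?_ (Submodule.Quotient.mk_eq_zero (x := x)
        ((S.B m n pq.1).submoduleOf (S.Z m n pq.1)))
      rw [ModuleCat.hom_zero, LinearMap.range_zero]
      rfl
  obtain ⟨e⟩ := (K.sc pq).nonempty_homology_equiv ψ (by
    ext y
    obtain ⟨y, rfl⟩ := Submodule.Quotient.mk_surjective _ y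
    refine Iff.trans ?_ (hout y).symm
    constructor
    · rintro ⟨x, hx⟩
      obtain ⟨z, hz⟩ := (Submodule.Quotient.mk_eq_zero _).mp (sub_eq_zero.mpr hx)
      have : (y : S.E n pq.1) = (x : S.E n pq.1) - S.a n pq.1 z := by
        rw [hz.2]
        simp [Submodule.coe_inclusion]
      rw [this]
      exact sub_mem x.2 (S.a_mem_Z _ _ _ _)
    · intro hy
      exact ⟨⟨y, hy⟩, rfl⟩) ((S.B (m + 1) n pq.1).submoduleOf (S.Z (m + 1) n pq.1))
    (fun x => (hin (Submodule.inclusion (S.Z_succ_le m n pq.1) x)).symm)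
  exact ⟨e.toModuleIso⟩

/-- The spectral sequence of a filtered couple. -/
noncomputable def spectralSequence : CohomologicalSpectralSequenceNat (ModuleCat.{v} k) 1 where
  page r hr := S.pageComplex (r - 1).toNat r (by omega)
  iso r r' pq hrr' hr := (show Nonempty _ by
    obtain ⟨m, rfl⟩ : ∃ m : ℕ, r = m + 1 := ⟨(r - 1).toNat, by omega⟩
    subst hrr'
    obtain ⟨e⟩ := S.nonempty_pageComplex_homology m (m + 1) (m + 1 + 1) rfl (by simp) pq
    refine ⟨eqToIso ?_ ≪≫ e ≪≫ eqToIso ?_⟩ <;> congr 1 <;> congr 1 <;> omega).some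

lemma nonempty_spectralSequence_page_one (p q : ℕ) :
    Nonempty ((S.spectralSequence.page 1 le_rfl).X (p, q) ≃ₗ[k] S.E (p + q) p) := by
  have hZ : S.Z 0 (p + q) p = ⊤ := top_unique fun x _ => ⟨S.b _ _ x, rfl⟩
  have hB : S.B 0 (p + q) p = ⊥ := Submodule.map_bot _
  change Nonempty ((S.Z 0 (p + q) p ⧸ (S.B 0 (p + q) p).submoduleOf (S.Z 0 (p + q) p)) ≃ₗ[k]
    S.E (p + q) p)
  rw [hZ, hB]
  exact ⟨(Submodule.quotEquivOfEqBot _ (by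
    rw [Submodule.submoduleOf, Submodule.comap_bot, Submodule.ker_subtype])).trans
      Submodule.topEquiv⟩

lemma convergesTo_spectralSequence : ConvergesTo S.spectralSequence fun n => S.D n 0 := by
  have hsub : ∀ n p, LinearMap.range (S.toZero n (p + 1)) ≤ LinearMap.range (S.toZero n p) :=
    fun n p => LinearMap.range_comp_le_range _ _
  refine ⟨fun n p => LinearMap.range (S.toZero n p), fun n => antitone_nat_of_succ_le (hsub n),
    fun n => LinearMap.range_id, fun n => ?_, fun p q r hr hp hq => ?_⟩
  · have := S.subsingleton_D n (n + 1) (by omega)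
    rw [eq_bot_iff]
    rintro _ ⟨x, rfl⟩
    rw [Subsingleton.elim x 0, map_zero]
    exact zero_mem _
  · set m := (r - 1).toNat with hm
    -- Since `m ≥ p` and `m > q`, the cycles are `ker b = range a` and the boundaries are the image
    -- under `a` of the kernel of the map to `D n 0`.
    obtain ⟨e⟩ := nonempty_range_quotient_equiv (S.a (p + q) p) (S.toZero (p + q) p)
      (S.Z m (p + q) p) (by
        rw [S.Z_of_lt (by omega)]
        exact (S.exact_a_b _ _).linearMap_ker_eq) (S.B m (p + q) p)
      (by rw [B, S.iterKer_of_le _ (by omega)])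
    -- The next filtration step is the image of `range c = ker a`.
    obtain ⟨e'⟩ := nonempty_range_quotient_equiv (S.toZero (p + q) p) (S.a (p + q) p)
      _ rfl (LinearMap.range (S.toZero (p + q) (p + 1))) (by
        rw [(S.exact_c_a _ _).linearMap_ker_eq, ← LinearMap.range_comp]
        rfl)
    exact ⟨e.trans ((Submodule.quotEquivOfEq _ _ (sup_comm _ _)).trans e'.symm)⟩

end FilteredCouple

/-! ### Short exact sequences of complexes: the associated couple and dimension shifting. -/

/-- A sequence of short exact sequences `0 → K p → B p → K (p + 1) → 0` of cochain complexes. -/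
structure SyzygySequence (k : Type u) [Field k] where
  K : ℕ → CochainComplex (ModuleCat.{v} k) ℕ
  B : ℕ → CochainComplex (ModuleCat.{v} k) ℕ
  f (p : ℕ) : K p ⟶ B p
  g (p : ℕ) : B p ⟶ K (p + 1)
  zero (p : ℕ) : f p ≫ g p = 0
  shortExact (p : ℕ) : (ShortComplex.mk (f p) (g p) (zero p)).ShortExact

/-- Regrading of a bigraded space: the term with filtration degree `p` and total degree `n` is
`X (s + p) (n - p)` if `p ≤ n` and zero otherwise. -/
def totalGrading {k : Type u} [Field k] (X : ℕ → ℕ → ModuleCat.{v} k) :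
    (s n p : ℕ) → ModuleCat.{v} k
  -- Recursion avoids the subtraction `n - p`: the clauses hold by unfolding, so the maps and
  -- exactness proofs below follow the same pattern without casts.
  | s, n, 0 => X s n
  | _, 0, _ + 1 => ModuleCat.of k PUnit
  | s, n + 1, p + 1 => totalGrading X (s + 1) n p
termination_by structural _ _ p => p

lemma nonempty_totalGrading_equiv {k : Type u} [Field k] (X : ℕ → ℕ → ModuleCat.{v} k)
    (s p q n i : ℕ) (hn : n = p + q) (hi : i = s + p) :
    Nonempty (totalGrading X s n p ≃ₗ[k] X i q) := by
  induction p generalizing s n with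
  | zero =>
    obtain rfl : n = q := by omega
    obtain rfl : i = s := hi
    exact ⟨LinearEquiv.refl k (X i n)⟩
  | succ p ih =>
    obtain ⟨n, rfl⟩ : ∃ m, n = m + 1 := ⟨p + q, by omega⟩
    exact ih (s + 1) n (by omega) (by omega)

lemma subsingleton_totalGrading {k : Type u} [Field k] (X : ℕ → ℕ → ModuleCat.{v} k)
    (s n p : ℕ) (h : n < p) : Subsingleton (totalGrading X s n p) := by
  induction p generalizing s n with
  | zero => omega
  | succ p ih =>
    cases n with
    | zero => exact inferInstanceAs (Subsingleton PUnit)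
    | succ n => exact ih (s + 1) n (by omega)

namespace SyzygySequence

variable {k : Type u} [Field k] (S : SyzygySequence.{u, v} k)

/-- The cohomology of `K p`. -/
noncomputable abbrev HK (p q : ℕ) : ModuleCat.{v} k := (S.K p).homology q

/-- The cohomology of `B p`. -/
noncomputable abbrev HB (p q : ℕ) : ModuleCat.{v} k := (S.B p).homology q

/-- The map induced by `K p → B p`. -/
noncomputable def a (p q : ℕ) : S.HK p q →ₗ[k] S.HB p q :=
  (HomologicalComplex.homologyMap (S.f p) q).hom

/-- The map induced by `B p → K (p + 1)`. -/
noncomputable def b (p q : ℕ) : S.HB p q →ₗ[k] S.HK (p + 1) q :=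
  (HomologicalComplex.homologyMap (S.g p) q).hom

/-- The connecting homomorphism. -/
noncomputable def c (p q : ℕ) : S.HK (p + 1) q →ₗ[k] S.HK p (q + 1) :=
  ((S.shortExact p).δ q (q + 1) rfl).hom

lemma exact_a_b (p q : ℕ) : Function.Exact (S.a p q) (S.b p q) :=
  (ShortComplex.ShortExact.moduleCat_exact_iff_function_exact _).mp
    ((S.shortExact p).homology_exact₂ q)

lemma exact_b_c (p q : ℕ) : Function.Exact (S.b p q) (S.c p q) :=
  (ShortComplex.ShortExact.moduleCat_exact_iff_function_exact _).mp
    ((S.shortExact p).homology_exact₃ q (q + 1) rfl)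

lemma exact_c_a (p q : ℕ) : Function.Exact (S.c p q) (S.a p (q + 1)) :=
  (ShortComplex.ShortExact.moduleCat_exact_iff_function_exact _).mp
    ((S.shortExact p).homology_exact₁ q (q + 1) rfl)

/-- The long exact sequence has nothing to the left of degree zero. -/
lemma injective_a (p : ℕ) : Function.Injective (S.a p 0) := by
  have := (S.shortExact p).mono_f
  have : Mono (S.f p) := this
  have : Mono ((S.f p).f 0) := inferInstance
  have : Mono (HomologicalComplex.homologyMap (S.f p) 0) :=
    HomologicalComplex.mono_homologyMap_of_mono_of_not_rel (S.f p) 0 (by simp)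
  exact (ModuleCat.mono_iff_injective _).mp this

/-- `HK (s + p + 1) (n - p - 1) → HK (s + p) (n - p)`. -/
noncomputable def totalC : (s n p : ℕ) →
    (totalGrading S.HK s n (p + 1) →ₗ[k] totalGrading S.HK s n p)
  | _, 0, _ => 0
  | s, n + 1, 0 => S.c s n
  | s, n + 1, p + 1 => totalC (s + 1) n p
termination_by structural _ _ p => p

/-- `HK (s + p) (n - p) → HB (s + p) (n - p)`. -/
noncomputable def totalA : (s n p : ℕ) →
    (totalGrading S.HK s n p →ₗ[k] totalGrading S.HB s n p)
  | s, n, 0 => S.a s n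
  | _, 0, _ + 1 => 0
  | s, n + 1, p + 1 => totalA (s + 1) n p
termination_by structural _ _ p => p

/-- `HB (s + p) (n - p) → HK (s + p + 1) (n - p)`. -/
noncomputable def totalB : (s n p : ℕ) →
    (totalGrading S.HB s n p →ₗ[k] totalGrading S.HK s (n + 1) (p + 1))
  | s, n, 0 => S.b s n
  | _, 0, _ + 1 => 0
  | s, n + 1, p + 1 => totalB (s + 1) n p
termination_by structural _ _ p => p

lemma exact_totalC_totalA (s n p : ℕ) :
    Function.Exact (S.totalC s n p) (S.totalA s n p) := by
  induction p generalizing s n with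
  | zero =>
    cases n with
    | zero =>
      -- On the diagonal the source of `c` is the zero space, so exactness is injectivity of `a` on
      -- `H^0`.
      exact (LinearMap.exact_zero_iff_injective PUnit.{v + 1} (S.a s 0)).mpr (S.injective_a s)
    | succ n => exact S.exact_c_a s n
  | succ p ih =>
    cases n with
    | zero =>
      have := subsingleton_totalGrading S.HK s 0 (p + 1) (by omega)
      exact fun x => ⟨fun _ => ⟨0, Subsingleton.elim _ _⟩, fun _ => rfl⟩
    | succ n => exact ih (s + 1) n

lemma exact_totalA_totalB (s n p : ℕ) :
    Function.Exact (S.totalA s n p) (S.totalB s n p) := by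
  induction p generalizing s n with
  | zero => exact S.exact_a_b s n
  | succ p ih =>
    cases n with
    | zero =>
      have := subsingleton_totalGrading S.HB s 0 (p + 1) (by omega)
      exact fun x => ⟨fun _ => ⟨0, Subsingleton.elim _ _⟩, fun _ => rfl⟩
    | succ n => exact ih (s + 1) n

lemma exact_totalB_totalC (s n p : ℕ) :
    Function.Exact (S.totalB s n p) (S.totalC s (n + 1) p) := by
  induction p generalizing s n with
  | zero => exact S.exact_b_c s n
  | succ p ih =>
    cases n with
    | zero =>
      have := subsingleton_totalGrading S.HK s 1 (p + 2) (by omega)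
      have := subsingleton_totalGrading S.HK s 1 (p + 1 + 1) (by omega)
      exact fun x => ⟨fun _ => ⟨0, Subsingleton.elim _ _⟩, fun _ =>
        (congrArg _ (Subsingleton.elim x 0)).trans (map_zero _)⟩
    | succ n => exact ih (s + 1) n

/-- The couple formed by the long exact cohomology sequences. -/
noncomputable def filteredCouple : FilteredCouple.{u, v} k where
  D := totalGrading S.HK 0
  E := totalGrading S.HB 0
  c := S.totalC 0
  a := S.totalA 0
  b := S.totalB 0
  exact_c_a := S.exact_totalC_totalA 0
  exact_a_b := S.exact_totalA_totalB 0
  exact_b_c := S.exact_totalB_totalC 0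
  subsingleton_D := subsingleton_totalGrading S.HK 0

theorem exists_spectralSequence :
    ∃ E : CohomologicalSpectralSequenceNat (ModuleCat.{v} k) 1,
      (∀ p q : ℕ, Nonempty ((E.page 1 le_rfl).X (p, q) ≃ₗ[k] (S.B p).homology q)) ∧
      ConvergesTo E (fun n => (S.K 0).homology n) := by
  refine ⟨S.filteredCouple.spectralSequence, fun p q => ?_,
    S.filteredCouple.convergesTo_spectralSequence⟩
  obtain ⟨e⟩ := S.filteredCouple.nonempty_spectralSequence_page_one p q
  obtain ⟨e'⟩ := nonempty_totalGrading_equiv S.HB 0 p q (p + q) p rfl (zero_add p).symm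
  exact ⟨e.trans e'⟩

/-- Dimension shifting: the connecting maps are surjective, and bijective from positive degrees,
since the middle terms are acyclic. Shifting `q` times leads to `H^1 (K n)`, which is the cokernel
of `H^0 (B n) → H^0 (K (n + 1))`. -/
lemma nonempty_HK_succ_equiv (h : ∀ p q, 1 ≤ q → Subsingleton (S.HB p q)) (n p q : ℕ) (hn : n = p + q) :
    Nonempty (S.HK p (q + 1) ≃ₗ[k] (S.HK (n + 1) 0 ⧸ LinearMap.range (S.b n 0))) := by
  have hsurj : ∀ p q, Function.Surjective (S.c p q) := by
    intro p q y
    have := h p (q + 1) (by omega)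
    exact (S.exact_c_a p q y).mp (Subsingleton.elim _ _)
  induction q generalizing p with
  | zero =>
    obtain rfl : n = p := hn
    exact ⟨((Submodule.quotEquivOfEq _ _ (S.exact_b_c n 0).linearMap_ker_eq.symm).trans
      ((S.c n 0).quotKerEquivOfSurjective (hsurj n 0))).symm⟩
  | succ q ih =>
    obtain ⟨e⟩ := ih (p + 1) (by omega)
    have hinj : Function.Injective (S.c p (q + 1)) := by
      rw [injective_iff_map_eq_zero]
      intro x hx
      have := h p (q + 1) (by omega)
      obtain ⟨y, rfl⟩ := (S.exact_b_c p (q + 1) x).mp hx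
      rw [Subsingleton.elim y 0, map_zero]
    exact ⟨(LinearEquiv.ofBijective _ ⟨hinj, hsurj p (q + 1)⟩).symm.trans e⟩

/-- If the complexes `B p` have no cohomology in positive degrees, the cohomology of `K 0` is that
of the complex formed by the `H^0 (B p)`. -/
theorem nonempty_homology_equiv (h : ∀ p q, 1 ≤ q → Subsingleton (S.HB p q))
    (L : CochainComplex (ModuleCat.{v} k) ℕ) (φ : ∀ p, L.X p ≃ₗ[k] S.HB p 0)
    (hφ : ∀ p x, φ (p + 1) ((L.d p (p + 1)).hom x) = S.a (p + 1) 0 (S.b p 0 (φ p x))) (n : ℕ) :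
    Nonempty (S.HK 0 n ≃ₗ[k] L.homology n) := by
  -- By left exactness of `H^0`, the `n`-cocycles of `L` are `H^0 (K n)`.
  let ψ : S.HK n 0 →ₗ[k] L.X n := (φ n).symm.toLinearMap ∘ₗ S.a n 0
  have hψ : LinearMap.range ψ = LinearMap.ker (L.d n ((ComplexShape.up ℕ).next n)).hom := by
    rw [CochainComplex.next]
    ext y
    have : (L.d n (n + 1)).hom y = 0 ↔ S.b n 0 (φ n y) = 0 := by
      rw [← (φ (n + 1)).map_eq_zero_iff, hφ,
        map_eq_zero_iff (S.a (n + 1) 0) (S.injective_a (n + 1))]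
    rw [LinearMap.mem_ker, this, S.exact_a_b]
    refine exists_congr fun x => ?_
    exact (φ n).symm_apply_eq
  cases n with
  | zero =>
    obtain ⟨e⟩ := (L.sc 0).nonempty_homology_equiv ψ hψ ⊥ (fun x => by
      have : L.d ((ComplexShape.up ℕ).prev 0) 0 = 0 := L.shape _ _ (by simp)
      change _ ↔ ψ x ∈ LinearMap.range (L.d ((ComplexShape.up ℕ).prev 0) 0).hom
      rw [this, ModuleCat.hom_zero, LinearMap.range_zero, Submodule.mem_bot, Submodule.mem_bot]
      exact (map_eq_zero_iff ψ ((φ 0).symm.injective.comp (S.injective_a 0))).symm)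
    exact ⟨((e.trans (Submodule.quotEquivOfEqBot _ rfl))).symm⟩
  | succ n =>
    obtain ⟨e⟩ := (L.sc (n + 1)).nonempty_homology_equiv ψ hψ (LinearMap.range (S.b n 0))
      (fun x => by
        change _ ↔ ψ x ∈ LinearMap.range (L.d ((ComplexShape.up ℕ).prev (n + 1)) (n + 1)).hom
        rw [CochainComplex.prev_nat_succ]
        constructor
        · rintro ⟨y, rfl⟩
          refine ⟨(φ n).symm y, ?_⟩
          apply (φ (n + 1)).injective
          rw [hφ]
          simp [ψ]
        · rintro ⟨y, hy⟩
          refine ⟨φ n y, S.injective_a (n + 1) ?_⟩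
          rw [← hφ, hy]
          simp [ψ])
    obtain ⟨e'⟩ := S.nonempty_HK_succ_equiv h n 0 n (zero_add n).symm
    exact ⟨e'.trans e.symm⟩

end SyzygySequence

/-! ### Exact sequences of complexes cut into syzygies. -/

lemma HomologicalComplex.exists_homology_zero_inclusion {k : Type u} [Field k]
    (K : CochainComplex (ModuleCat.{v} k) ℕ) :
    Function.Injective (K.isoHomologyπ₀.inv ≫ K.iCycles 0).hom ∧
      LinearMap.range (K.isoHomologyπ₀.inv ≫ K.iCycles 0).hom =
        LinearMap.ker (K.d 0 1).hom := by
  refine ⟨(ModuleCat.mono_iff_injective _).mp inferInstance, le_antisymm ?_ ?_⟩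
  · rintro _ ⟨x, rfl⟩
    have : (K.isoHomologyπ₀.inv ≫ K.iCycles 0) ≫ K.d 0 1 = 0 := by simp
    exact LinearMap.congr_fun (congrArg ModuleCat.Hom.hom this) x
  · intro x hx
    let i : ModuleCat.of k (LinearMap.ker (K.d 0 1).hom) ⟶ K.X 0 :=
      ModuleCat.ofHom (Submodule.subtype _)
    have hi : i ≫ K.d 0 1 = 0 := by
      ext y
      exact y.2
    have : (K.liftCycles i 1 (by simp) hi ≫ K.isoHomologyπ₀.hom) ≫
        (K.isoHomologyπ₀.inv ≫ K.iCycles 0) = i := by simp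
    exact ⟨_, LinearMap.congr_fun (congrArg ModuleCat.Hom.hom this) ⟨x, hx⟩⟩

section

variable {k : Type u} [Field k] (Y : ℕ → CochainComplex (ModuleCat.{v} k) ℕ)
  (d : ∀ p, Y p ⟶ Y (p + 1))

/-- The syzygies of a sequence `0 → Y 0 → Y 1 → Y 2 → ⋯` of cochain complexes. -/
noncomputable def syzygy : ℕ → CochainComplex (ModuleCat.{v} k) ℕ
  -- Taking `Y 0` itself, instead of the isomorphic kernel of `d 1`, makes the abutment literally
  -- its cohomology.
  | 0 => Y 0
  | p + 1 => kernel (d (p + 2))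

/-- The inclusion of the syzygies. -/
noncomputable def syzygyι : (p : ℕ) → (syzygy Y d p ⟶ Y (p + 1))
  | 0 => d 0
  | p + 1 => kernel.ι (d (p + 2))

variable (hd : ∀ p, d p ≫ d (p + 1) = 0)
  (hexact : ∀ p, (ShortComplex.mk (d p) (d (p + 1)) (hd p)).Exact)

include hexact in
lemma exact_syzygyι (p : ℕ) : ∃ h : syzygyι Y d p ≫ d (p + 1) = 0,
    (ShortComplex.mk (syzygyι Y d p) (d (p + 1)) h).Exact := by
  cases p with
  | zero => exact ⟨hd 0, hexact 0⟩
  | succ p => exact ⟨kernel.condition _, ShortComplex.exact_kernel _⟩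

/-- The projection to the syzygies. -/
noncomputable def syzygyπ (p : ℕ) : Y (p + 1) ⟶ syzygy Y d (p + 1) :=
  kernel.lift (d (p + 2)) (d (p + 1)) (hd (p + 1))

lemma syzygyπ_syzygyι (p : ℕ) : syzygyπ Y d hd p ≫ syzygyι Y d (p + 1) = d (p + 1) :=
  kernel.lift_ι _ _ _

lemma mono_syzygyι (hmono : Mono (d 0)) (p : ℕ) : Mono (syzygyι Y d p) := by
  cases p with
  | zero => exact hmono
  | succ p => exact inferInstanceAs (Mono (kernel.ι (d (p + 2))))

include hexact in
lemma epi_syzygyπ (p : ℕ) : Epi (syzygyπ Y d hd p) := (hexact (p + 1)).epi_kernelLift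

/-- The syzygies of an exact sequence `0 → Y 0 → Y 1 → Y 2 → ⋯` of cochain complexes. -/
noncomputable def SyzygySequence.ofExact (hmono : Mono (d 0)) : SyzygySequence.{u, v} k where
  K := syzygy Y d
  B p := Y (p + 1)
  f := syzygyι Y d
  g := syzygyπ Y d hd
  zero p := by
    have := mono_syzygyι Y d hmono (p + 1)
    rw [← cancel_mono (syzygyι Y d (p + 1)), Category.assoc, syzygyπ_syzygyι, zero_comp]
    exact (exact_syzygyι Y d hd hexact p).choose
  shortExact p := by
    obtain ⟨h, he⟩ := exact_syzygyι Y d hd hexact p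
    have hm := mono_syzygyι Y d hmono
    have hz : syzygyι Y d p ≫ syzygyπ Y d hd p = 0 := by
      rw [← cancel_mono (syzygyι Y d (p + 1)), Category.assoc, syzygyπ_syzygyι, zero_comp, h]
    have := hm p
    refine ShortComplex.ShortExact.mk' ?_ this (epi_syzygyπ Y d hd hexact p)
    -- Exactness at `Y (p + 1)` is unaffected by replacing the last term `Y (p + 2)` by the
    -- subobject through which the map factors.
    let φ : ShortComplex.mk _ _ hz ⟶ ShortComplex.mk _ _ h :=
      { τ₁ := 𝟙 _
        τ₂ := 𝟙 _
        τ₃ := syzygyι Y d (p + 1)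
        comm₂₃ := (Category.id_comp _).trans (syzygyπ_syzygyι Y d hd p).symm }
    have : Epi φ.τ₁ := inferInstanceAs (Epi (𝟙 _))
    have : IsIso φ.τ₂ := inferInstanceAs (IsIso (𝟙 _))
    have : Mono φ.τ₃ := hm (p + 1)
    exact (ShortComplex.exact_iff_of_epi_of_isIso_of_mono φ).mpr he

lemma SyzygySequence.ofExact_a_b (hmono : Mono (d 0)) (p q : ℕ) (x) :
    (ofExact Y d hd hexact hmono).a (p + 1) q ((ofExact Y d hd hexact hmono).b p q x) =
      (HomologicalComplex.homologyMap (d (p + 1)) q).hom x := by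
  conv_rhs => rw [← syzygyπ_syzygyι Y d hd p, HomologicalComplex.homologyMap_comp]
  rfl

/-- The hypercohomology spectral sequence of a resolution `0 → Y 0 → Y 1 → Y 2 → ⋯`. -/
theorem exists_spectralSequence_of_exact (hmono : Mono (d 0))
    (hexact : ∀ p, (ShortComplex.mk (d p) (d (p + 1)) (hd p)).Exact) :
    ∃ E : CohomologicalSpectralSequenceNat (ModuleCat.{v} k) 1,
      (∀ p q : ℕ, Nonempty ((E.page 1 le_rfl).X (p, q) ≃ₗ[k] (Y (p + 1)).homology q)) ∧
      ConvergesTo E (fun n => (Y 0).homology n) :=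
  (SyzygySequence.ofExact Y d hd hexact hmono).exists_spectralSequence

/-- If `0 → Y 0 → Y 1 → Y 2 → ⋯` is exact and `Y p`, for `p ≥ 1`, is a resolution of `L.X (p - 1)`,
then `Y 0` and `L` have the same cohomology. -/
theorem nonempty_homology_equiv_of_exact (hmono : Mono (d 0))
    (hexact : ∀ p, (ShortComplex.mk (d p) (d (p + 1)) (hd p)).Exact)
    (h : ∀ p q, 1 ≤ q → Subsingleton ((Y (p + 1)).homology q))
    (L : CochainComplex (ModuleCat.{v} k) ℕ) (ψ : ∀ p, L.X p →ₗ[k] (Y (p + 1)).X 0)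
    (hinj : ∀ p, Function.Injective (ψ p))
    (hrange : ∀ p, LinearMap.range (ψ p) = LinearMap.ker ((Y (p + 1)).d 0 1).hom)
    (hψ : ∀ p x, ψ (p + 1) ((L.d p (p + 1)).hom x) = ((d (p + 1)).f 0).hom (ψ p x)) (n : ℕ) :
    Nonempty ((Y 0).homology n ≃ₗ[k] L.homology n) := by
  let i (p) := (Y (p + 1)).isoHomologyπ₀.inv ≫ (Y (p + 1)).iCycles 0
  have hi (p) : Function.Injective (i p).hom := (Y (p + 1)).exists_homology_zero_inclusion.1
  have hir (p) : LinearMap.range (i p).hom = LinearMap.range (ψ p) :=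
    (Y (p + 1)).exists_homology_zero_inclusion.2.trans (hrange p).symm
  -- `ψ p` and the inclusion of `H^0` are both injective with image the kernel of the first
  -- differential, so they identify their sources.
  let φ (p) : L.X p ≃ₗ[k] (Y (p + 1)).homology 0 :=
    (LinearEquiv.ofInjective (ψ p) (hinj p)).trans ((LinearEquiv.ofEq _ _ (hir p).symm).trans
      (LinearEquiv.ofInjective (i p).hom (hi p)).symm)
  have hφ (p) (x) : (i p).hom (φ p x) = ψ p x :=
    congrArg Subtype.val ((LinearEquiv.ofInjective (i p).hom (hi p)).apply_symm_apply
      (LinearEquiv.ofEq _ _ (hir p).symm (LinearEquiv.ofInjective (ψ p) (hinj p) x)))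
  have hcomm (p) (x) : φ (p + 1) ((L.d p (p + 1)).hom x) =
      (HomologicalComplex.homologyMap (d (p + 1)) 0).hom (φ p x) := by
    apply hi
    rw [hφ, hψ, ← hφ]
    have : HomologicalComplex.homologyMap (d (p + 1)) 0 ≫ i (p + 1) = i p ≫ (d (p + 1)).f 0 := by
      simp [i, CochainComplex.isoHomologyπ₀_inv_naturality_assoc]
    exact (LinearMap.congr_fun (congrArg ModuleCat.Hom.hom this) (φ p x)).symm
  exact (SyzygySequence.ofExact Y d hd hexact hmono).nonempty_homology_equiv h L φ
    (fun p x => (hcomm p x).trans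
      (SyzygySequence.ofExact_a_b Y d hd hexact hmono p 0 (φ p x)).symm) n

end

/-! ### Functoriality and exactness of the cobar complex. -/

section

variable {k : Type u} [Field k] {C : Type v} [AddCommGroup C] [Module k C]

lemma cobarStep_tmul {M X : Type v} [AddCommGroup M] [Module k M] [AddCommGroup X] [Module k X]
    (ρ : M →ₗ[k] M ⊗[k] C) (δ : X →ₗ[k] C ⊗[k] X) (m : M) (x : X) :
    cobarStep ρ δ (m ⊗ₜ x) = TensorProduct.assoc k M C X (ρ m ⊗ₜ x) - m ⊗ₜ δ x := by
  simp [cobarStep]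

lemma cobarStep_comp_lTensor {M X X' : Type v} [AddCommGroup M] [Module k M] [AddCommGroup X]
    [Module k X] [AddCommGroup X'] [Module k X'] (ρ : M →ₗ[k] M ⊗[k] C) (δ : X →ₗ[k] C ⊗[k] X)
    (δ' : X' →ₗ[k] C ⊗[k] X') (g : X →ₗ[k] X') (h : δ' ∘ₗ g = g.lTensor C ∘ₗ δ) :
    cobarStep ρ δ' ∘ₗ g.lTensor M = (g.lTensor C).lTensor M ∘ₗ cobarStep ρ δ := by
  have e : ∀ (s : M ⊗[k] C) (x : X), (g.lTensor C).lTensor M (TensorProduct.assoc k M C X (s ⊗ₜ x))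
      = TensorProduct.assoc k M C X' (s ⊗ₜ g x) := by
    intro s x
    induction s with
    | zero => simp
    | add a b ha hb => simp only [TensorProduct.add_tmul, map_add, ha, hb]
    | tmul m c => simp
  ext m x
  have := LinearMap.congr_fun h x
  simp only [LinearMap.comp_apply] at this
  simp [cobarStep_tmul, e, this]

variable [Coalgebra k C]

/-- A linear map commuting with the coactions. -/
def LeftComodule.IsColinear {W W' : LeftComodule k C} (f : W.carrier →ₗ[k] W'.carrier) : Prop :=
  W'.coact ∘ₗ f = f.lTensor C ∘ₗ W.coact

/-- The map `C^{⊗ n} ⊗ f`. -/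
noncomputable def cobarObjMap {W W' : LeftComodule k C} (f : W.carrier →ₗ[k] W'.carrier) :
    (n : ℕ) → (cobarObj W n →ₗ[k] cobarObj W' n)
  | 0 => f
  | n + 1 => (cobarObjMap f n).lTensor C

lemma cobarTail_comp_cobarObjMap {W W' : LeftComodule k C} {f : W.carrier →ₗ[k] W'.carrier}
    (hf : LeftComodule.IsColinear f) (n : ℕ) :
    cobarTail W' n ∘ₗ cobarObjMap f n = (cobarObjMap f n).lTensor C ∘ₗ cobarTail W n := by
  induction n with
  | zero => exact hf
  | succ n ih => exact cobarStep_comp_lTensor _ _ _ _ ih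

lemma exact_cobarObjMap {W W' W'' : LeftComodule k C} {f : W.carrier →ₗ[k] W'.carrier}
    {g : W'.carrier →ₗ[k] W''.carrier} (h : Function.Exact f g) (n : ℕ) :
    Function.Exact (cobarObjMap f n) (cobarObjMap g n) := by
  induction n with
  | zero => exact h
  | succ n ih => exact Module.Flat.lTensor_exact C ih

lemma injective_cobarObjMap {W W' : LeftComodule k C} {f : W.carrier →ₗ[k] W'.carrier}
    (h : Function.Injective f) (n : ℕ) : Function.Injective (cobarObjMap f n) := by
  induction n with
  | zero => exact h
  | succ n ih => exact Module.Flat.lTensor_preserves_injective_linearMap _ ih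

lemma cobarComplex_d (V : RightComodule k C) (W : LeftComodule k C) (n : ℕ) :
    (cobarComplex V W).d n (n + 1) = ModuleCat.ofHom (cobarD V W n) :=
  CochainComplex.of_d (fun n => ModuleCat.of k (V.carrier ⊗[k] cobarObj W n))
    (fun n => ModuleCat.ofHom (cobarD V W n)) n

/-- The cobar complex is functorial in the second variable. -/
noncomputable def cobarMap (V : RightComodule k C) {W W' : LeftComodule k C}
    (f : W.carrier →ₗ[k] W'.carrier) (hf : LeftComodule.IsColinear f) :
    cobarComplex V W ⟶ cobarComplex V W' :=
  CochainComplex.ofHom (V := ModuleCat.{v} k) (α := ℕ)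
    (fun n => ModuleCat.ofHom ((cobarObjMap f n).lTensor V.carrier))
    (fun n => by
      change ModuleCat.ofHom ((cobarObjMap f n).lTensor V.carrier) ≫
        (cobarComplex V W').d n (n + 1) =
        (cobarComplex V W).d n (n + 1) ≫ ModuleCat.ofHom ((cobarObjMap f (n + 1)).lTensor V.carrier)
      rw [cobarComplex_d, cobarComplex_d]
      exact ModuleCat.hom_ext (cobarStep_comp_lTensor _ _ _ _ (cobarTail_comp_cobarObjMap hf n)))

lemma cobarMap_comp_eq_zero (V : RightComodule k C) {W W' W'' : LeftComodule k C}
    {f : W.carrier →ₗ[k] W'.carrier} {g : W'.carrier →ₗ[k] W''.carrier}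
    (hf : LeftComodule.IsColinear f) (hg : LeftComodule.IsColinear g) (h : Function.Exact f g) :
    cobarMap V f hf ≫ cobarMap V g hg = 0 := by
  ext n : 2
  exact (Module.Flat.lTensor_exact V.carrier (exact_cobarObjMap h n)).linearMap_comp_eq_zero

lemma exact_cobarMap (V : RightComodule k C) {W W' W'' : LeftComodule k C}
    {f : W.carrier →ₗ[k] W'.carrier} {g : W'.carrier →ₗ[k] W''.carrier}
    (hf : LeftComodule.IsColinear f) (hg : LeftComodule.IsColinear g) (h : Function.Exact f g) :
    (ShortComplex.mk _ _ (cobarMap_comp_eq_zero V hf hg h)).Exact :=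
  HomologicalComplex.exact_of_degreewise_exact _ fun n =>
    (ShortComplex.ShortExact.moduleCat_exact_iff_function_exact _).mpr
      (Module.Flat.lTensor_exact V.carrier (exact_cobarObjMap h n))

lemma mono_cobarMap (V : RightComodule k C) {W W' : LeftComodule k C}
    {f : W.carrier →ₗ[k] W'.carrier} (hf : LeftComodule.IsColinear f) (h : Function.Injective f) :
    Mono (cobarMap V f hf) := by
  have : ∀ n, Mono ((cobarMap V f hf).f n) := fun n =>
    (ModuleCat.mono_iff_injective _).mpr
      (Module.Flat.lTensor_preserves_injective_linearMap _ (injective_cobarObjMap h n))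
  exact HomologicalComplex.mono_of_mono_f _ this

lemma subsingleton_cotor_succ_iff (V : RightComodule k C) (W : LeftComodule k C) (n : ℕ) :
    Subsingleton (Cotor V W (n + 1)) ↔ Function.Exact (cobarD V W n) (cobarD V W (n + 1)) := by
  rw [← ModuleCat.isZero_iff_subsingleton, Cotor, ← HomologicalComplex.exactAt_iff_isZero_homology,
    HomologicalComplex.exactAt_iff' _ n (n + 1) (n + 2) (by simp) (by simp),
    ShortComplex.ShortExact.moduleCat_exact_iff_function_exact]
  have h1 := cobarComplex_d V W n
  have h2 := cobarComplex_d V W (n + 1)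
  change Function.Exact ((cobarComplex V W).d n (n + 1)).hom
    ((cobarComplex V W).d (n + 1) (n + 1 + 1)).hom ↔ _
  rw [h1, h2]
  rfl

end

/-! ### Coinduced comodules and the relative cobar resolution. -/

section

variable {k : Type u} [Field k] {C D : Type v} [AddCommGroup C] [Module k C] [Coalgebra k C]
  [AddCommGroup D] [Module k D] [Coalgebra k D]

lemma LeftComodule.IsColinear.sub {W W' : LeftComodule k C} {f g : W.carrier →ₗ[k] W'.carrier}
    (hf : IsColinear f) (hg : IsColinear g) : IsColinear (f - g) := by
  rw [IsColinear, LinearMap.comp_sub, LinearMap.lTensor_sub, LinearMap.sub_comp, hf, hg]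

/-- Tensoring with `C` over a field preserves injectivity. Colinearity of maps into `C □_D P` is
thus checked in `C ⊗ P`. -/
lemma LeftComodule.IsColinear.of_comp {W W' W'' : LeftComodule k C}
    {f : W.carrier →ₗ[k] W'.carrier} {i : W'.carrier →ₗ[k] W''.carrier} (hi : IsColinear i)
    (hinj : Function.Injective i) (h : IsColinear (i ∘ₗ f)) : IsColinear f := by
  have hinj' : Function.Injective (i.lTensor C) :=
    Module.Flat.lTensor_preserves_injective_linearMap i hinj
  refine LinearMap.ext fun x => hinj' ?_
  have h1 := LinearMap.congr_fun hi (f x)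
  have h2 := LinearMap.congr_fun h x
  simp only [LinearMap.comp_apply, LinearMap.lTensor_comp] at h1 h2 ⊢
  rw [← h1, h2]

lemma LeftComodule.IsColinear.comp {W W' W'' : LeftComodule k C}
    {f : W.carrier →ₗ[k] W'.carrier} {g : W'.carrier →ₗ[k] W''.carrier} (hg : IsColinear g)
    (hf : IsColinear f) : IsColinear (g ∘ₗ f) := by
  rw [IsColinear, ← LinearMap.comp_assoc, hg, LinearMap.comp_assoc, hf, LinearMap.lTensor_comp,
    LinearMap.comp_assoc]

lemma LeftComodule.IsColinear.corestrict {W W' : LeftComodule k C}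
    {f : W.carrier →ₗ[k] W'.carrier} (hf : IsColinear f) (π : C →ₗc[k] D) :
    IsColinear (W := W.corestrict π) (W' := W'.corestrict π) f := by
  change (π.toLinearMap.rTensor W'.carrier ∘ₗ W'.coact) ∘ₗ f =
    f.lTensor D ∘ₗ π.toLinearMap.rTensor W.carrier ∘ₗ W.coact
  rw [LinearMap.comp_assoc, hf, ← LinearMap.comp_assoc, ← LinearMap.comp_assoc,
    LinearMap.rTensor_comp_lTensor, LinearMap.lTensor_comp_rTensor]

lemma LeftComodule.isColinear_lTensor (P : LeftComodule k C) {X X' : Type v} [AddCommGroup X]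
    [Module k X] [AddCommGroup X'] [Module k X'] (f : X →ₗ[k] X') :
    IsColinear (W := P.tensorRight X) (W' := P.tensorRight X') (f.lTensor P.carrier) := by
  have e : ∀ (s : C ⊗[k] P.carrier) (x : X), TensorProduct.assoc k C P.carrier X' (s ⊗ₜ f x) =
      (f.lTensor P.carrier).lTensor C (TensorProduct.assoc k C P.carrier X (s ⊗ₜ x)) := by
    intro s x
    induction s with
    | zero => simp
    | add a b ha hb => simp only [TensorProduct.add_tmul, map_add, ha, hb]
    | tmul m c => simp
  refine TensorProduct.ext' fun p x => ?_
  simp [e]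

/-- The term from `ρ` is colinear because the two coactions commute, the term from `δ` because it
leaves the factor `P` alone. For `P = C` this gives the `C`-coaction on `C □_D T` and the
colinearity of its cofree resolution. -/
lemma LeftComodule.isColinear_cobarStep {E : Type v} [AddCommGroup E] [Module k E]
    (P : LeftComodule k C)
    (ρ : P.carrier →ₗ[k] P.carrier ⊗[k] E)
    (h : (TensorProduct.assoc k C P.carrier E).toLinearMap ∘ₗ P.coact.rTensor E ∘ₗ ρ =
      ρ.lTensor C ∘ₗ P.coact) {X : Type v} [AddCommGroup X] [Module k X] (δ : X →ₗ[k] E ⊗[k] X) :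
    IsColinear (W := P.tensorRight X) (W' := P.tensorRight (E ⊗[k] X)) (cobarStep ρ δ) := by
  have e1 : ∀ (s : P.carrier ⊗[k] E) (t : X),
      (P.tensorRight (E ⊗[k] X)).coact (TensorProduct.assoc k P.carrier E X (s ⊗ₜ t)) =
      (TensorProduct.assoc k P.carrier E X).toLinearMap.lTensor C
        (TensorProduct.assoc k C (P.carrier ⊗[k] E) X
          (TensorProduct.assoc k C P.carrier E (P.coact.rTensor E s) ⊗ₜ t)) := by
    intro s t
    induction s with
    | zero => simp
    | add a b ha hb => simp only [TensorProduct.add_tmul, map_add, ha, hb]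
    | tmul p d =>
      simp only [LinearMap.comp_apply, TensorProduct.assoc_tmul, LinearMap.rTensor_tmul,
        LinearEquiv.coe_coe]
      generalize P.coact p = r
      induction r with
      | zero => simp
      | add a b ha hb => simp only [TensorProduct.add_tmul, map_add, ha, hb]
      | tmul d d' => simp
  have e2 : ∀ (s : C ⊗[k] P.carrier) (t : X),
      (cobarStep ρ δ).lTensor C (TensorProduct.assoc k C P.carrier X (s ⊗ₜ t)) =
      (TensorProduct.assoc k P.carrier E X).toLinearMap.lTensor C
        (TensorProduct.assoc k C (P.carrier ⊗[k] E) X (ρ.lTensor C s ⊗ₜ t)) -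
      TensorProduct.assoc k C P.carrier (E ⊗[k] X) (s ⊗ₜ δ t) := by
    intro s t
    induction s with
    | zero => simp
    | add a b ha hb =>
      simp only [TensorProduct.add_tmul, map_add, ha, hb]
      abel
    | tmul d p => simp [cobarStep_tmul, TensorProduct.tmul_sub]
  refine TensorProduct.ext' fun p t => ?_
  have h1 := LinearMap.congr_fun h p
  have h2 := e1 (ρ p) t
  have h3 := e2 (P.coact p) t
  simp only [LinearMap.comp_apply, LinearEquiv.coe_coe] at h1 h2
  rw [h1] at h2
  simp only [LinearMap.comp_apply, LinearMap.rTensor_tmul, LinearEquiv.coe_coe]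
  rw [h3, cobarStep_tmul, map_sub, map_sub, h2]
  simp

/-- The left coaction of `C` and the right coaction of `D` on `C` commute. -/
lemma regular_comm (π : C →ₗc[k] D) :
    (TensorProduct.assoc k C C D).toLinearMap ∘ₗ (LeftComodule.regular k C).coact.rTensor D ∘ₗ
      ((RightComodule.regular k C).corestrict π).coact =
    (((RightComodule.regular k C).corestrict π).coact).lTensor C ∘ₗ
      (LeftComodule.regular k C).coact := by
  have e1 : ∀ s : C ⊗[k] C, TensorProduct.assoc k C C D
      (Coalgebra.comul.rTensor D (π.toLinearMap.lTensor C s)) =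
      (π.toLinearMap.lTensor C).lTensor C
        (TensorProduct.assoc k C C C (Coalgebra.comul.rTensor C s)) := by
    intro s
    induction s with
    | zero => simp
    | add a b ha hb => simp only [map_add, ha, hb]
    | tmul a b =>
      simp only [LinearMap.lTensor_tmul, LinearMap.rTensor_tmul]
      generalize (Coalgebra.comul (R := k) a) = r
      induction r with
      | zero => simp
      | add a b ha hb => simp only [TensorProduct.add_tmul, map_add, ha, hb]
      | tmul d d' => simp
  refine LinearMap.ext fun c => ?_
  refine (e1 (Coalgebra.comul c)).trans ?_
  refine (congrArg _ (Coalgebra.coassoc_apply (R := k) (A := C) c)).trans ?_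
  exact (LinearMap.lTensor_comp_apply C (π.toLinearMap.lTensor C) Coalgebra.comul _).symm

/-- The cotensor product `C □_D T` is stable under the left coaction of `C`. -/
lemma cotensor_regular_stable (π : C →ₗc[k] D) (T : LeftComodule k D) (x : C ⊗[k] T.carrier)
    (hx : x ∈ cotensor ((RightComodule.regular k C).corestrict π) T) :
    ((LeftComodule.regular k C).tensorRight T.carrier).coact x ∈ LinearMap.range
      ((cotensor ((RightComodule.regular k C).corestrict π) T).subtype.lTensor C) := by
  refine (Module.Flat.lTensor_exact C (LinearMap.exact_subtype_ker_map
    (cotensorMap ((RightComodule.regular k C).corestrict π) T)) _).mp ?_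
  have := LinearMap.congr_fun
    ((LeftComodule.regular k C).isColinear_cobarStep _ (regular_comm π) T.coact) x
  exact this.symm.trans ((congrArg
    ((LeftComodule.regular k C).tensorRight (D ⊗[k] T.carrier)).coact hx).trans (map_zero _))

/-- The coinduced left `C`-comodule `C □_D T`, with the coaction of `C`. -/
noncomputable def coinduced (π : C →ₗc[k] D) (T : LeftComodule k D) : LeftComodule k C :=
  LeftComodule.sub ((LeftComodule.regular k C).tensorRight T.carrier)
    (cotensor ((RightComodule.regular k C).corestrict π) T) (cotensor_regular_stable π T)

/-- The inclusion `C □_D T → C ⊗ T`. -/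
noncomputable def coinducedι (π : C →ₗc[k] D) (T : LeftComodule k D) :
    (coinduced π T).carrier →ₗ[k] ((LeftComodule.regular k C).tensorRight T.carrier).carrier :=
  (cotensor ((RightComodule.regular k C).corestrict π) T).subtype

lemma injective_coinducedι (π : C →ₗc[k] D) (T : LeftComodule k D) :
    Function.Injective (coinducedι π T) := Submodule.injective_subtype _

lemma isColinear_coinducedι (π : C →ₗc[k] D) (T : LeftComodule k D) :
    LeftComodule.IsColinear (coinducedι π T) :=
  (LeftComodule.subtype_subCoact _ _ (cotensor_regular_stable π T)).symm

lemma LeftComodule.mk_coact_congr {M : Type v} [AddCommGroup M] [Module k M]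
    {δ δ' : M →ₗ[k] C ⊗[k] M} (h : δ = δ') (h1 h2 h1' h2') :
    (⟨M, δ, h1, h2⟩ : LeftComodule k C) = ⟨M, δ', h1', h2'⟩ := by
  subst h
  rfl

/-- Both sides have the same carrier, and their coactions agree inside `D ⊗ (C ⊗ T)`. An equality,
rather than an isomorphism, can be substituted under the iteration in `cotensorPower`. -/
lemma cotensorComodule_eq_corestrict (π : C →ₗc[k] D) (T : LeftComodule k D) :
    cotensorComodule π T = (coinduced π T).corestrict π := by
  refine LeftComodule.mk_coact_congr (M := (coinduced π T).carrier)
    (δ := (cotensorComodule π T).coact) (δ' := ((coinduced π T).corestrict π).coact) ?_ _ _ _ _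
  have hinj : Function.Injective ((coinducedι π T).lTensor D) :=
    Module.Flat.lTensor_preserves_injective_linearMap _ (injective_coinducedι π T)
  have e : ∀ (s : C ⊗[k] C) (t : T.carrier),
      TensorProduct.assoc k D C T.carrier (π.toLinearMap.rTensor C s ⊗ₜ t) =
      π.toLinearMap.rTensor (C ⊗[k] T.carrier) (TensorProduct.assoc k C C T.carrier (s ⊗ₜ t)) := by
    intro s t
    induction s with
    | zero => simp
    | add a b ha hb => simp only [TensorProduct.add_tmul, map_add, ha, hb]
    | tmul a b => simp
  have h0 : (((LeftComodule.regular k C).corestrict π).tensorRight T.carrier).coact =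
      π.toLinearMap.rTensor (C ⊗[k] T.carrier) ∘ₗ
        ((LeftComodule.regular k C).tensorRight T.carrier).coact :=
    TensorProduct.ext' fun c t => e (Coalgebra.comul c) t
  have h1 : (coinducedι π T).lTensor D ∘ₗ (cotensorComodule π T).coact =
      (((LeftComodule.regular k C).corestrict π).tensorRight T.carrier).coact ∘ₗ coinducedι π T :=
    LeftComodule.subtype_subCoact _ _ (cotensor_stable ((LeftComodule.regular k C).corestrict π)
      ((RightComodule.regular k C).corestrict π).coact (regular_corestrict_comm π) T)
  have h2 := (isColinear_coinducedι π T).corestrict π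
  have h2' : (coinducedι π T).lTensor D ∘ₗ ((coinduced π T).corestrict π).coact =
      π.toLinearMap.rTensor (C ⊗[k] T.carrier) ∘ₗ
        ((LeftComodule.regular k C).tensorRight T.carrier).coact ∘ₗ coinducedι π T := h2.symm
  refine LinearMap.ext fun x => hinj ?_
  refine (LinearMap.congr_fun h1 x).trans ?_
  rw [h0]
  exact (LinearMap.congr_fun h2' x).symm

/-- Elements equalised over `C` are therefore equalised over `D`; so the coaction of `P` lands in `C
□_D P`. -/
lemma cobarStep_corestrict (π : C →ₗc[k] D) {M X : Type v} [AddCommGroup M] [Module k M]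
    [AddCommGroup X] [Module k X] (ρ : M →ₗ[k] M ⊗[k] C) (δ : X →ₗ[k] C ⊗[k] X) :
    cobarStep (π.toLinearMap.lTensor M ∘ₗ ρ) (π.toLinearMap.rTensor X ∘ₗ δ) =
      (π.toLinearMap.rTensor X).lTensor M ∘ₗ cobarStep ρ δ := by
  have e : ∀ (s : M ⊗[k] C) (x : X),
      TensorProduct.assoc k M D X (π.toLinearMap.lTensor M s ⊗ₜ x) =
      (π.toLinearMap.rTensor X).lTensor M (TensorProduct.assoc k M C X (s ⊗ₜ x)) := by
    intro s x
    induction s with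
    | zero => simp
    | add a b ha hb => simp only [TensorProduct.add_tmul, map_add, ha, hb]
    | tmul m c => simp
  refine TensorProduct.ext' fun m x => ?_
  simp only [cobarStep_tmul, LinearMap.comp_apply, map_sub, e, LinearMap.lTensor_tmul]

/-- The comodule `C □_D P` for a `C`-comodule `P`. -/
noncomputable abbrev relCoinduced (π : C →ₗc[k] D) (P : LeftComodule k C) : LeftComodule k C :=
  coinduced π (P.corestrict π)

/-- The inclusion `C □_D P → C ⊗ P`. -/
noncomputable def relCoinducedι (π : C →ₗc[k] D) (P : LeftComodule k C) :
    (relCoinduced π P).carrier →ₗ[k] C ⊗[k] P.carrier :=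
  coinducedι π (P.corestrict π)

lemma injective_relCoinducedι (π : C →ₗc[k] D) (P : LeftComodule k C) :
    Function.Injective (relCoinducedι π P) := injective_coinducedι _ _

lemma isColinear_relCoinducedι (π : C →ₗc[k] D) (P : LeftComodule k C) :
    LeftComodule.IsColinear (W' := (LeftComodule.regular k C).tensorRight P.carrier)
      (relCoinducedι π P) := isColinear_coinducedι _ _

/-- The coaction, as a map `P → C □_D P`. -/
noncomputable def relUnit (π : C →ₗc[k] D) (P : LeftComodule k C) :
    P.carrier →ₗ[k] (relCoinduced π P).carrier :=
  P.coact.codRestrict (cotensor ((RightComodule.regular k C).corestrict π) (P.corestrict π)) (by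
    intro p
    refine (LinearMap.congr_fun (cobarStep_corestrict π _ _) (P.coact p)).trans ?_
    refine (congrArg _ (LinearMap.congr_fun (cobarTail_comp_cobarTail P 0) p)).trans ?_
    exact map_zero _)

lemma isColinear_relUnit (π : C →ₗc[k] D) (P : LeftComodule k C) :
    LeftComodule.IsColinear (relUnit π P) :=
  (isColinear_relCoinducedι π P).of_comp (injective_relCoinducedι π P) P.coassoc

/-- The map `C □_D f`. -/
noncomputable def relMap (π : C →ₗc[k] D) {P P' : LeftComodule k C}
    (f : P.carrier →ₗ[k] P'.carrier) (hf : LeftComodule.IsColinear f) :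
    (relCoinduced π P).carrier →ₗ[k] (relCoinduced π P').carrier :=
  (f.lTensor C ∘ₗ relCoinducedι π P).codRestrict
    (cotensor ((RightComodule.regular k C).corestrict π) (P'.corestrict π)) (by
    intro x
    have hx : cotensorMap ((RightComodule.regular k C).corestrict π) (P.corestrict π)
      (relCoinducedι π P x) = 0 := x.2
    refine (LinearMap.congr_fun (cobarStep_comp_lTensor
      ((RightComodule.regular k C).corestrict π).coact _ _ f (hf.corestrict π))
      (relCoinducedι π P x)).trans ?_
    exact (congrArg _ hx).trans (map_zero _))

lemma isColinear_relMap (π : C →ₗc[k] D) {P P' : LeftComodule k C}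
    (f : P.carrier →ₗ[k] P'.carrier) (hf : LeftComodule.IsColinear f) :
    LeftComodule.IsColinear (relMap π f hf) := by
  refine (isColinear_relCoinducedι π P').of_comp (injective_relCoinducedι π P') ?_
  exact ((LeftComodule.regular k C).isColinear_lTensor f).comp (isColinear_relCoinducedι π P)

lemma relMap_comp_relUnit (π : C →ₗc[k] D) {P P' : LeftComodule k C}
    (f : P.carrier →ₗ[k] P'.carrier) (hf : LeftComodule.IsColinear f) :
    relMap π f hf ∘ₗ relUnit π P = relUnit π P' ∘ₗ f :=
  LinearMap.ext fun x => injective_relCoinducedι π P' (LinearMap.congr_fun hf x).symm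

/-- The map `C □_D P → P` induced by the counit. -/
noncomputable def relCounit (π : C →ₗc[k] D) (P : LeftComodule k C) :
    (relCoinduced π P).carrier →ₗ[k] P.carrier :=
  (TensorProduct.lid k P.carrier).toLinearMap ∘ₗ
    (Coalgebra.counit (R := k) (A := C)).rTensor P.carrier ∘ₗ relCoinducedι π P

lemma relCounit_relUnit (π : C →ₗc[k] D) (P : LeftComodule k C) (p : P.carrier) :
    relCounit π P (relUnit π P p) = p := by
  refine (congrArg (TensorProduct.lid k P.carrier) (LinearMap.congr_fun P.counit_coact p)).trans ?_
  exact TensorProduct.lid_tmul _ _ |>.trans (one_smul _ _)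

lemma relCounit_relMap (π : C →ₗc[k] D) {P P' : LeftComodule k C}
    (f : P.carrier →ₗ[k] P'.carrier) (hf : LeftComodule.IsColinear f)
    (x : (relCoinduced π P).carrier) :
    relCounit π P' (relMap π f hf x) = f (relCounit π P x) := by
  have e : (TensorProduct.lid k P'.carrier).toLinearMap ∘ₗ
      (Coalgebra.counit (R := k) (A := C)).rTensor P'.carrier ∘ₗ f.lTensor C =
      f ∘ₗ (TensorProduct.lid k P.carrier).toLinearMap ∘ₗ
      (Coalgebra.counit (R := k) (A := C)).rTensor P.carrier := by
    ext c p
    simp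
  exact LinearMap.congr_fun e (relCoinducedι π P x)

/-- The map `C □_D P → C □_D C □_D P`, `c ⊗ p ↦ c₁ ⊗ c₂ ⊗ p - c ⊗ f(p)`. -/
noncomputable def relStep (π : C →ₗc[k] D) {P : LeftComodule k C}
    (f : P.carrier →ₗ[k] (relCoinduced π P).carrier) (hf : LeftComodule.IsColinear f) :
    (relCoinduced π P).carrier →ₗ[k] (relCoinduced π (relCoinduced π P)).carrier :=
  relUnit π (relCoinduced π P) - relMap π f hf

lemma isColinear_relStep (π : C →ₗc[k] D) {P : LeftComodule k C}
    (f : P.carrier →ₗ[k] (relCoinduced π P).carrier) (hf : LeftComodule.IsColinear f) :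
    LeftComodule.IsColinear (relStep π f hf) :=
  (isColinear_relUnit π _).sub (isColinear_relMap π f hf)

lemma relStep_relUnit (π : C →ₗc[k] D) (P : LeftComodule k C) :
    relStep π (relUnit π P) (isColinear_relUnit π P) ∘ₗ relUnit π P = 0 := by
  rw [relStep, LinearMap.sub_comp, relMap_comp_relUnit, sub_self]

/-- Write `G` for `C □_D -`, `η` for the unit and `f' = η - G f`. Naturality gives `η f' = G f' η`,
hence `(η - G f') f' = G f' (η - f') = G (f' f) = 0`. -/
lemma relStep_relStep (π : C →ₗc[k] D) {P : LeftComodule k C}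
    (f : P.carrier →ₗ[k] (relCoinduced π P).carrier) (hf : LeftComodule.IsColinear f)
    (h : relStep π f hf ∘ₗ f = 0) :
    relStep π (relStep π f hf) (isColinear_relStep π f hf) ∘ₗ relStep π f hf = 0 := by
  have h0 : relMap π (relStep π f hf) (isColinear_relStep π f hf) ∘ₗ relMap π f hf = 0 := by
    refine LinearMap.ext fun x => injective_relCoinducedι π _ ?_
    refine (LinearMap.lTensor_comp_apply C (relStep π f hf) f
      (relCoinducedι π P x)).symm.trans ?_
    rw [h, LinearMap.lTensor_zero]
    exact (map_zero _).symm
  have h1 : relUnit π (relCoinduced π P) = relStep π f hf + relMap π f hf :=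
    (sub_add_cancel _ _).symm
  conv_lhs => enter [1]; rw [relStep]
  rw [LinearMap.sub_comp, ← relMap_comp_relUnit π _ (isColinear_relStep π f hf), h1, LinearMap.comp_add, h0, add_zero, sub_self]

/-- The counit `ε` satisfies `ε η = id` and `ε (G f) = f ε`, so `η x = (G f) x` forces `x = f (ε
x)`. The contraction need not be colinear. -/
lemma exact_relStep (π : C →ₗc[k] D) {P : LeftComodule k C}
    (f : P.carrier →ₗ[k] (relCoinduced π P).carrier) (hf : LeftComodule.IsColinear f)
    (h : relStep π f hf ∘ₗ f = 0) : Function.Exact f (relStep π f hf) := by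
  intro x
  constructor
  · intro hx
    have h := congrArg (relCounit π (relCoinduced π P)) hx
    rw [relStep, LinearMap.sub_apply, map_sub, map_zero, relCounit_relUnit, relCounit_relMap,
      sub_eq_zero] at h
    exact ⟨_, h.symm⟩
  · rintro ⟨y, rfl⟩
    exact LinearMap.congr_fun h y

/-- The left `C`-comodule `C^{□_D i} □_D W`, with the coaction of the first factor. -/
noncomputable def relPower (π : C →ₗc[k] D) (W : LeftComodule k C) : ℕ → LeftComodule k C
  | 0 => W
  | i + 1 => relCoinduced π (relPower π W i)

lemma cotensorPower_eq_corestrict (π : C →ₗc[k] D) (W : LeftComodule k C) (i : ℕ) :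
    cotensorPower π (W.corestrict π) i = (relPower π W i).corestrict π := by
  induction i with
  | zero => rfl
  | succ i ih =>
    refine (congrArg (cotensorComodule π) ih).trans ?_
    exact cotensorComodule_eq_corestrict π _

/-- The differentials of the relative cobar resolution `W → C □_D W → C □_D C □_D W → ⋯`. -/
noncomputable def relDelta (π : C →ₗc[k] D) (W : LeftComodule k C) : (i : ℕ) →
    {f : (relPower π W i).carrier →ₗ[k] (relCoinduced π (relPower π W i)).carrier //
      LeftComodule.IsColinear f ∧ ∀ hf, relStep π f hf ∘ₗ f = 0}
  | 0 => ⟨relUnit π W, isColinear_relUnit π W, fun _ => relStep_relUnit π W⟩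
  -- Colinearity is needed to form the next map and the vanishing to propagate itself, so both are
  -- carried through the recursion.
  | i + 1 => ⟨relStep π (relDelta π W i).1 (relDelta π W i).2.1, isColinear_relStep π _ _,
      fun _ => relStep_relStep π _ _ ((relDelta π W i).2.2 _)⟩

end

/-! ### Acyclicity of cofree comodules and `Cotor` of coinduced comodules. -/

section

variable {k : Type u} [Field k]

/-- One more tensor factor on the left preserves a contracting homotopy acting on the right: the
terms from `ρ` cancel, and the sign `e` flips because `δ` enters `cobarStep` negatively. -/
lemma cobarStep_homotopy {C : Type v} [AddCommGroup C] [Module k C] {M Y' : Type v}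
    [AddCommGroup M] [Module k M] [AddCommGroup Y'] [Module k Y'] (ρ : M →ₗ[k] M ⊗[k] C)
    (δ' : Y' →ₗ[k] C ⊗[k] Y') (δ : C ⊗[k] Y' →ₗ[k] C ⊗[k] (C ⊗[k] Y'))
    (g : C ⊗[k] Y' →ₗ[k] Y') (e : k)
    (h : g.lTensor C ∘ₗ δ = δ' ∘ₗ g + e • LinearMap.id) :
    (g.lTensor C).lTensor M ∘ₗ cobarStep ρ δ =
      cobarStep ρ δ' ∘ₗ g.lTensor M + (-e) • LinearMap.id := by
  have h1 : ∀ (s : M ⊗[k] C) (y : C ⊗[k] Y'),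
      (g.lTensor C).lTensor M (TensorProduct.assoc k M C (C ⊗[k] Y') (s ⊗ₜ y)) =
        TensorProduct.assoc k M C Y' (s ⊗ₜ g y) := by
    intro s y
    induction s with
    | zero => simp
    | add a b ha hb => simp only [TensorProduct.add_tmul, map_add, ha, hb]
    | tmul m c => simp
  refine TensorProduct.ext' fun m y => ?_
  have h2 := LinearMap.congr_fun h y
  simp only [LinearMap.comp_apply, LinearMap.add_apply, LinearMap.smul_apply,
    LinearMap.id_apply] at h2
  simp only [LinearMap.comp_apply, LinearMap.add_apply, LinearMap.smul_apply, LinearMap.id_apply,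
    cobarStep_tmul, map_sub, h1, LinearMap.lTensor_tmul, h2, TensorProduct.tmul_add,
    TensorProduct.tmul_smul, neg_smul]
  abel

variable {C D : Type v} [AddCommGroup C] [Module k C] [Coalgebra k C]
  [AddCommGroup D] [Module k D] [Coalgebra k D]

variable (k C) in
/-- The cofree left comodule `C ⊗ X`. -/
noncomputable abbrev cofree (X : Type v) [AddCommGroup X] [Module k X] : LeftComodule k C :=
  (LeftComodule.regular k C).tensorRight X

variable (k C) in
/-- The map `C ⊗ X → X` induced by the counit. -/
noncomputable def cofreeCounit (X : Type v) [AddCommGroup X] [Module k X] : C ⊗[k] X →ₗ[k] X :=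
  (TensorProduct.lid k X).toLinearMap ∘ₗ (Coalgebra.counit (R := k) (A := C)).rTensor X

/-- This treats the cofree coaction as one more cobar step, starting from the zero map on `X`, so
the general lemmas on `cobarStep` apply to it. -/
lemma cobarStep_comul_zero (X : Type v) [AddCommGroup X] [Module k X] :
    cobarStep (Coalgebra.comul (R := k) (A := C)) (0 : X →ₗ[k] C ⊗[k] X) =
      (cofree k C X).coact := by
  rw [cobarStep, LinearMap.lTensor_zero, sub_zero]
  rfl

lemma lTensor_cofreeCounit_assoc {M X : Type v} [AddCommGroup M] [Module k M] [AddCommGroup X]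
    [Module k X] (s : M ⊗[k] C) (x : X) :
    (cofreeCounit k C X).lTensor M (TensorProduct.assoc k M C X (s ⊗ₜ x)) =
      TensorProduct.rid k M ((Coalgebra.counit (R := k) (A := C)).lTensor M s) ⊗ₜ x := by
  induction s with
  | zero => simp
  | add a b ha hb => simp only [TensorProduct.add_tmul, map_add, ha, hb]
  | tmul m c => simp [cofreeCounit, TensorProduct.smul_tmul]

lemma lTensor_cofreeCounit_cobarStep (V : RightComodule k C) (X : Type v) [AddCommGroup X]
    [Module k X] :
    (cofreeCounit k C X).lTensor V.carrier ∘ₗ cobarStep V.coact (0 : X →ₗ[k] C ⊗[k] X) =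
      LinearMap.id := by
  refine TensorProduct.ext' fun v x => ?_
  have h := LinearMap.congr_fun V.counit_coact v
  simp only [LinearMap.comp_apply] at h
  rw [LinearMap.comp_apply, cobarStep_tmul, LinearMap.zero_apply, TensorProduct.tmul_zero, sub_zero,
    lTensor_cofreeCounit_assoc, h]
  simp

lemma lTensor_cofreeCounit_comul (X : Type v) [AddCommGroup X] [Module k X] :
    (cofreeCounit k C X).lTensor C ∘ₗ
        cobarStep (Coalgebra.comul (R := k) (A := C)) (0 : X →ₗ[k] C ⊗[k] X) =
      0 ∘ₗ cofreeCounit k C X + (1 : k) • LinearMap.id := by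
  rw [LinearMap.zero_comp, zero_add, one_smul]
  exact lTensor_cofreeCounit_cobarStep (RightComodule.regular k C) X

/-- The maps `C^{⊗ (n + 1)} ⊗ C ⊗ X → C^{⊗ n} ⊗ C ⊗ X` applying the counit to the last factor
`C`. -/
noncomputable def cofreeContraction (X : Type v) [AddCommGroup X] [Module k X] :
    (n : ℕ) → (cobarObj (cofree k C X) (n + 1) →ₗ[k] cobarObj (cofree k C X) n)
  | 0 => (cofreeCounit k C X).lTensor C
  | n + 1 => (cofreeContraction X n).lTensor C

lemma cofreeContraction_cobarTail (X : Type v) [AddCommGroup X] [Module k X] (n : ℕ) :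
    (cofreeContraction (C := C) X n).lTensor C ∘ₗ cobarTail (cofree k C X) (n + 1) =
      cobarTail (cofree k C X) n ∘ₗ cofreeContraction X n +
        ((-1 : k) ^ (n + 1)) • LinearMap.id := by
  induction n with
  | zero =>
    have := cobarStep_homotopy (Coalgebra.comul (R := k) (A := C)) 0 _ _ _
      (lTensor_cofreeCounit_comul X)
    rw [cobarStep_comul_zero] at this
    rw [show (-1 : k) = (-1) ^ (0 + 1) by rw [zero_add, pow_one]] at this
    exact this
  | succ n ih =>
    have := cobarStep_homotopy (Coalgebra.comul (R := k) (A := C)) _ _ _ _ ih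
    rw [pow_succ, mul_neg_one]
    exact this

/-- The counit on the last factor `C` contracts the complex up to sign: a cocycle `x` is the
differential of `±` its contraction. -/
lemma subsingleton_cotor_cofree (V : RightComodule k C) (X : Type v) [AddCommGroup X]
    [Module k X] (n : ℕ) (hn : 1 ≤ n) : Subsingleton (Cotor V (cofree k C X) n) := by
  obtain ⟨n, rfl⟩ : ∃ m, n = m + 1 := ⟨n - 1, by omega⟩
  rw [subsingleton_cotor_succ_iff]
  intro x
  constructor
  · intro hx
    have h := LinearMap.congr_fun
      (cobarStep_homotopy V.coact (cobarTail (cofree k C X) n) (cobarTail (cofree k C X) (n + 1))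
        (cofreeContraction X n) _ (cofreeContraction_cobarTail (C := C) X n)) x
    have h' : (0 : V.carrier ⊗[k] cobarObj (cofree k C X) (n + 1)) =
        cobarD V (cofree k C X) n ((cofreeContraction X n).lTensor V.carrier x) +
          (-(-1 : k) ^ (n + 1)) • x := by
      refine Eq.trans ?_ h
      let c := ((cofreeContraction (k := k) (C := C) X n).lTensor C).lTensor V.carrier
      exact (map_zero c).symm.trans (congrArg c hx).symm
    refine ⟨((-1 : k) ^ (n + 1)) • (cofreeContraction X n).lTensor V.carrier x, ?_⟩
    rw [neg_smul, eq_comm, add_neg_eq_zero] at h'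
    rw [map_smul, h', smul_smul, ← mul_pow, neg_one_mul, neg_neg, one_pow, one_smul]
  · rintro ⟨y, rfl⟩
    exact LinearMap.congr_fun (cobarStep_comp_cobarStep V _
      (cobarTail_comp_cobarTail (cofree k C X) n)) y

/-- With `injective_cobarStep_zero`, this identifies `V ⊗ X` with `Cotor_C^0(V, C ⊗ X)` through `v ⊗
x ↦ v₀ ⊗ v₁ ⊗ x`. -/
lemma range_cobarStep_zero (V : RightComodule k C) (X : Type v) [AddCommGroup X] [Module k X] :
    LinearMap.range (cobarStep V.coact (0 : X →ₗ[k] C ⊗[k] X)) =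
      LinearMap.ker (cobarD V (cofree k C X) 0) := by
  ext x
  constructor
  · rintro ⟨y, rfl⟩
    have := LinearMap.congr_fun (cobarStep_comp_cobarStep V (0 : X →ₗ[k] C ⊗[k] X)
      (LinearMap.comp_zero _)) y
    rw [cobarStep_comul_zero] at this
    exact this
  · intro hx
    have h1 := LinearMap.congr_fun
      (cobarStep_homotopy V.coact _ _ _ _ (lTensor_cofreeCounit_comul X)) x
    rw [cobarStep_comul_zero] at h1
    have h' : (0 : V.carrier ⊗[k] (C ⊗[k] X)) =
        cobarStep V.coact (0 : X →ₗ[k] C ⊗[k] X) ((cofreeCounit k C X).lTensor V.carrier x) +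
          (-1 : k) • x := by
      refine Eq.trans ?_ h1
      let c := ((cofreeCounit k C X).lTensor C).lTensor V.carrier
      exact (map_zero c).symm.trans (congrArg c hx).symm
    rw [neg_one_smul, eq_comm, add_neg_eq_zero] at h'
    exact ⟨_, h'⟩

lemma injective_cobarStep_zero (V : RightComodule k C) (X : Type v) [AddCommGroup X]
    [Module k X] : Function.Injective (cobarStep V.coact (0 : X →ₗ[k] C ⊗[k] X)) :=
  Function.LeftInverse.injective (LinearMap.congr_fun (lTensor_cofreeCounit_cobarStep V X))

/-- By coassociativity of `V`, the embeddings `V ⊗ X → V ⊗ C ⊗ X` carry the `D`-cobar differential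
of `V` to `V` tensored with that of `C`. -/
lemma cobarStep_zero_comp_cobarStep (π : C →ₗc[k] D) (V : RightComodule k C) {X : Type v}
    [AddCommGroup X] [Module k X] (δ : X →ₗ[k] D ⊗[k] X) :
    cobarStep V.coact (0 : D ⊗[k] X →ₗ[k] C ⊗[k] (D ⊗[k] X)) ∘ₗ
        cobarStep (π.toLinearMap.lTensor V.carrier ∘ₗ V.coact) δ =
      (cobarStep (π.toLinearMap.lTensor C ∘ₗ Coalgebra.comul (R := k) (A := C)) δ).lTensor V.carrier ∘ₗ
        cobarStep V.coact (0 : X →ₗ[k] C ⊗[k] X) := by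
  -- Both composites contain `v₀ ⊗ v₁ ⊗ π(v₂) ⊗ x`; `Θ x` produces it from either bracketing of the
  -- iterated coaction.
  let Θ (x : X) : V.carrier ⊗[k] (C ⊗[k] C) →ₗ[k] V.carrier ⊗[k] (C ⊗[k] (D ⊗[k] X)) :=
    ((TensorProduct.mk k D X).flip x ∘ₗ π.toLinearMap).lTensor C |>.lTensor V.carrier
  have e1 : ∀ (s : V.carrier ⊗[k] C) (x : X),
      cobarStep V.coact (0 : D ⊗[k] X →ₗ[k] C ⊗[k] (D ⊗[k] X))
        (TensorProduct.assoc k V.carrier D X (π.toLinearMap.lTensor V.carrier s ⊗ₜ x)) =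
      Θ x (TensorProduct.assoc k V.carrier C C (V.coact.rTensor C s)) := by
    intro s x
    induction s with
    | zero => simp
    | add a b ha hb => simp only [TensorProduct.add_tmul, map_add, ha, hb]
    | tmul v c =>
      simp only [LinearMap.lTensor_tmul, TensorProduct.assoc_tmul, cobarStep_tmul,
        LinearMap.zero_apply, TensorProduct.tmul_zero, sub_zero, LinearMap.rTensor_tmul]
      generalize V.coact v = r
      induction r with
      | zero => simp
      | add a b ha hb => simp only [TensorProduct.add_tmul, map_add, ha, hb]
      | tmul a b => simp [Θ]
  have e2 : ∀ (s : V.carrier ⊗[k] C) (x : X),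
      (cobarStep (π.toLinearMap.lTensor C ∘ₗ Coalgebra.comul (R := k) (A := C)) δ).lTensor V.carrier
        (TensorProduct.assoc k V.carrier C X (s ⊗ₜ x)) =
      Θ x ((Coalgebra.comul (R := k) (A := C)).lTensor V.carrier s) -
        TensorProduct.assoc k V.carrier C (D ⊗[k] X) (s ⊗ₜ δ x) := by
    intro s x
    induction s with
    | zero => simp
    | add a b ha hb =>
      simp only [TensorProduct.add_tmul, map_add, ha, hb]
      abel
    | tmul v c =>
      have e3 : ∀ r : C ⊗[k] C, TensorProduct.assoc k C D X (π.toLinearMap.lTensor C r ⊗ₜ x) =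
          ((TensorProduct.mk k D X).flip x ∘ₗ π.toLinearMap).lTensor C r := by
        intro r
        induction r with
        | zero => simp
        | add a b ha hb => simp only [TensorProduct.add_tmul, map_add, ha, hb]
        | tmul a b => simp
      rw [TensorProduct.assoc_tmul, TensorProduct.assoc_tmul, LinearMap.lTensor_tmul,
        LinearMap.lTensor_tmul, LinearMap.lTensor_tmul, ← e3, ← TensorProduct.tmul_sub]
      exact congrArg (v ⊗ₜ ·) (cobarStep_tmul _ δ c x)
  refine TensorProduct.ext' fun v x => ?_
  have h := LinearMap.congr_fun V.coassoc v
  simp only [LinearMap.comp_apply, LinearEquiv.coe_coe] at h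
  have h1 := e1 (V.coact v) x
  have h2 := e2 (V.coact v) x
  rw [h] at h1
  simp only [LinearMap.comp_apply, cobarStep_tmul, LinearMap.zero_apply, TensorProduct.tmul_zero,
    sub_zero, map_sub, h2, h1]

/-- The terms of the resolution `C □_D T → C ⊗ T → C ⊗ D ⊗ T → ⋯`. -/
noncomputable def coinducedResolution (π : C →ₗc[k] D) (T : LeftComodule k D) :
    ℕ → LeftComodule k C
  | 0 => coinduced π T
  | b + 1 => cofree k C (cobarObj T b)

/-- The differentials of the resolution `C □_D T → C ⊗ T → C ⊗ D ⊗ T → ⋯`. -/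
noncomputable def coinducedResolutionD (π : C →ₗc[k] D) (T : LeftComodule k D) : (b : ℕ) →
    ((coinducedResolution π T b).carrier →ₗ[k] (coinducedResolution π T (b + 1)).carrier)
  | 0 => coinducedι π T
  | b + 1 => cobarD ((RightComodule.regular k C).corestrict π) T b

lemma isColinear_coinducedResolutionD (π : C →ₗc[k] D) (T : LeftComodule k D) (b : ℕ) :
    LeftComodule.IsColinear (coinducedResolutionD π T b) := by
  cases b with
  | zero => exact isColinear_coinducedι π T
  | succ b =>
    exact (LeftComodule.regular k C).isColinear_cobarStep _ (regular_comm π) (cobarTail T b)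

/-- At `C ⊗ T` this is the definition of the cotensor product; further on it is the vanishing of
`Cotor_D^{b+1}(C, T)`. -/
lemma exact_coinducedResolutionD (π : C →ₗc[k] D)
    (hright : ((RightComodule.regular k C).corestrict π).Coflat) (T : LeftComodule k D) (b : ℕ) :
    Function.Exact (coinducedResolutionD π T b) (coinducedResolutionD π T (b + 1)) := by
  cases b with
  | zero => exact LinearMap.exact_subtype_ker_map _
  | succ b => exact (subsingleton_cotor_succ_iff _ _ _).mp (hright T (b + 1) (by omega))

/-- If `C` is a coflat right `D`-comodule, `Cotor_C(V, C □_D T)` is `Cotor_D(V, T)`. -/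
theorem nonempty_cotor_coinduced_equiv (π : C →ₗc[k] D)
    (hright : ((RightComodule.regular k C).corestrict π).Coflat) (V : RightComodule k C)
    (T : LeftComodule k D) (n : ℕ) :
    Nonempty (Cotor V (coinduced π T) n ≃ₗ[k] Cotor (V.corestrict π) T n) := by
  refine nonempty_homology_equiv_of_exact
    (fun b => cobarComplex V (coinducedResolution π T b))
    (fun b => cobarMap V (coinducedResolutionD π T b) (isColinear_coinducedResolutionD π T b))
    (fun b => cobarMap_comp_eq_zero V _ _ (exact_coinducedResolutionD π hright T b))
    (mono_cobarMap V _ (injective_coinducedι π T))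
    (fun b => exact_cobarMap V _ _ (exact_coinducedResolutionD π hright T b))
    (fun b q hq => subsingleton_cotor_cofree V (cobarObj T b) q hq)
    (cobarComplex (V.corestrict π) T)
    (fun b => cobarStep V.coact (0 : cobarObj T b →ₗ[k] C ⊗[k] cobarObj T b))
    (fun b => injective_cobarStep_zero V (cobarObj T b)) (fun b => ?_) (fun b x => ?_) n
  · change _ = LinearMap.ker ((cobarComplex V (cofree k C (cobarObj T b))).d 0 (0 + 1)).hom
    rw [cobarComplex_d]
    exact range_cobarStep_zero V (cobarObj T b)
  · rw [cobarComplex_d]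
    exact LinearMap.congr_fun (cobarStep_zero_comp_cobarStep π V (cobarTail T b)) x

/-- The relative cobar resolution of `W` gives rise to a spectral sequence. -/
theorem exists_relative_cotor_spectralSequence (π : C →ₗc[k] D)
    (hright : ((RightComodule.regular k C).corestrict π).Coflat)
    (V : RightComodule k C) (W : LeftComodule k C) :
    ∃ E : CohomologicalSpectralSequenceNat (ModuleCat.{v} k) 1,
      (∀ i j : ℕ, Nonempty ((E.page 1 le_rfl).X (i, j) ≃ₗ[k]
        Cotor (V.corestrict π) (cotensorPower π (W.corestrict π) i) j)) ∧
      ConvergesTo E (fun n => Cotor V W n) := by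
  have hcolin (i : ℕ) : LeftComodule.IsColinear (W' := relPower π W (i + 1)) (relDelta π W i).1 :=
    (relDelta π W i).2.1
  have hexact (i : ℕ) : Function.Exact (relDelta π W i).1 (relDelta π W (i + 1)).1 :=
    exact_relStep π _ _ ((relDelta π W i).2.2 _)
  obtain ⟨E, h1, h2⟩ := exists_spectralSequence_of_exact
    (fun i => cobarComplex V (relPower π W i))
    (fun i => cobarMap V (relDelta π W i).1 (hcolin i))
    (fun i => cobarMap_comp_eq_zero V _ _ (hexact i))
    (mono_cobarMap V _ (Function.LeftInverse.injective (relCounit_relUnit π W)))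
    (fun i => exact_cobarMap V _ _ (hexact i))
  refine ⟨E, fun i j => ?_, h2⟩
  obtain ⟨e⟩ := h1 i j
  -- Column `i` comes from the resolution term of index `i + 1`, which is coinduced from the power
  -- of index `i`.
  obtain ⟨e'⟩ := nonempty_cotor_coinduced_equiv π hright V ((relPower π W i).corestrict π) j
  rw [cotensorPower_eq_corestrict]
  exact ⟨e.trans e'⟩

end

theorem mainTheorem5 {k : Type u} [Field k] [CharZero k] {C D : Type v}
    [AddCommGroup C] [Module k C] [Coalgebra k C] [AddCommGroup D] [Module k D] [Coalgebra k D]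
    (π : C →ₗc[k] D)
    (hleft : ((LeftComodule.regular k C).corestrict π).Coflat)
    (hright : ((RightComodule.regular k C).corestrict π).Coflat)
    (V : RightComodule k C) (W : LeftComodule k C) :
    ∃ E : CategoryTheory.CohomologicalSpectralSequenceNat (ModuleCat.{v} k) 1,
      (∀ i j : ℕ, Nonempty ((E.page 1 le_rfl).X (i, j) ≃ₗ[k]
        Cotor (V.corestrict π) (cotensorPower π (W.corestrict π) i) j)) ∧
      ConvergesTo E (fun n => Cotor V W n) :=
  exists_relative_cotor_spectralSequence π hright V W
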